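/- **Conventions.** Write $\overline X=X^{-1}$, $\overline Y=Y^{-1}$. Words $R=R(X,Y)$ are read cyclically, and all subwords below are cyclic subwords. The *X-letters* of $R$ are its letters $X$ and $\overline X$; $x_i$ denotes the $i$-th one. A *$(1,1)$ knot* $K\subset S^3$ is a (tame) knot such that, for some genus one Heegaard splitting $S^3=V_1\cup V_2$, each $K\cap V_i$ is a single trivial arc (there is an embedded disk $D\subset V_i$ with $K\cap V_i\subseteq\partial D$ such that $\partial D\cap\partial V_i$ is $\partial D$ minus the interior of the arc). $\Delta_K(t)\in\mathbb Z[t,t^{-1}]$ is the symmetrized Alexander polynomial: with $G=\pi_1(S^3\setminus K)$ and $C=[G,G]$, the module $C/[C,C]$ is isomorphic to $\mathbb Z[t,t^{-1}]/(\Delta_K)$, where $t$ acts by conjugation by an element whose class generates $G/C\cong\mathbb Z$, and $\Delta_K(t^{-1})=\Delta_K(t)$, $\Delta_K(1)=1$. **Disk words.** Let $\varphi(W)$ be the number of letters $X$ minus the number of letters $\overline X$ in $W$. A *primitive disk word* is a subword $W_1^n$ with X-letters numbered $1,\dots,n$, starting and ending with X-letters of opposite signs, with $\varphi(W_1^n)=0$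 and $\varphi(W_1^k)\ne0$ for $1<k<n$ ($W_a^b$ is the part from the $a$-th to the $b$-th X-letter). It is *upward* if it starts with $X$, *downward* if it starts with $\overline X$, *elementary* if $n=2$. The elementary words $X\overline Y\,\overline X$, $\overline X YX$ are positive, $XY\overline X$, $\overline X\,\overline YX$ are negative; a primitive disk word is *positive* if it contains more positive than negative elementary words, and *negative* otherwise. **Quasi-geometric.** A presentation $\langle X,Y\mid R\rangle$ with $R$ cyclically reduced is *quasi-geometric* if $\varphi(R)=1$; every subword $XY^k\overline X$ or $\overline XY^kX$ has $|k|=1$; and $|l-l'|\le1$ whenever $R$ has a subword $XY^lX$ or $\overline X\,\overline Y^{\,l}\,\overline X$ and a subword $XY^{l'}X$ or $\overline X\,\overline Y^{\,l'}\,\overline X$ ($l,l'\in\mathbb Z$). **Basepoint numbers.** For a quasi-geometric presentation, $P(W)=(n_z(W),n_w(W))$ is defined recursively for primitive disk words: * $P(XY\overline X)=(0,-1)$, $P(X\overline Y\,\overline X)=(0,1)$, $P(\overline XYX)=(1,0)$, $P(\overline X\,\overline YX)=(-1,0)$. * If $W=W_1^n$ is upward and positive, $n>2$, let $2=k_1<\dots<k_{d+1}=n-1$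 be the X-letters of height one (the height of the $i$-th X-letter is $\varphi(W_1^i)-1$ if it is $X$ and $\varphi(W_1^i)$ if it is $\overline X$), and let $W_1^2=XY^lX$, $W_{n-1}^n=\overline X\,\overline Y^{\,l'}\,\overline X$. Then $P(W)=P(S)+\sum_{i=1}^dP(W_{k_i}^{k_{i+1}})$, where $P(S)=(1,0)$ if $l=l'+1$; $P(S)=(0,1)$ if $l'=l+1$; and, if $l=l'$, $P(S)=(1,1)$ when $d\ge2$ and both $W_2^{k_2}$ and $W_{k_d}^{n-1}$ are positive, $P(S)=(0,0)$ otherwise. * If $W$ is upward and negative, $P(W)=-P(\widetilde W)$ with $\widetilde W$ obtained by inverting all Y-letters. If $W$ is downward and negative, $(n_z,n_w)(W)=-(n_w,n_z)(\widetilde W)$ with $\widetilde W$ obtained by inverting all X-letters. If $W$ is downward and positive, $(n_z,n_w)(W)=(n_w,n_z)(\widetilde W)$ with $\widetilde W$ obtained by inverting all letters. **Gradings.** For every primitive disk word $W$ of $R$ from $x_i$ to $x_j$, the relative gradings $F$, $M$, $w$ (integer functions on the X-letters) satisfy $F(x_i)-F(x_j)=n_z(W)-n_w(W)$, $M(x_i)-M(x_j)=\pm1-2n_w(W)$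 ($+$ if $W$ is positive, $-$ if negative), and $w(x_i)-w(x_j)=n_w(W)$. The absolute grading $F$ is normalized by $\#\{x\mid F(x)=s\}\equiv\#\{x\mid F(x)=-s\}\pmod 2$ for all $s\in\mathbb Z$. For the absolute grading $M$, apply the *deletion process*: (a) delete, one after another, primitive disk words of $R$ with $n_w=0$ whose two ends are still present, until none is left; (b) in the resulting relator, delete, one after another, primitive disk words (of the current relator) whose two ends have the same $w$-grading, $w$ being the grading of the original $R$. If this leaves exactly one X-letter $x_k$, normalize $M$ by $M(x_k)=0$. The presentation is *pseudo-geometric* if it is quasi-geometric, the relative grading $F$ can be normalized as above, and the deletion process can be carried out so that exactly one X-letter is left. The *Poincaré polynomial* of the resulting absolutely bigraded complex (free on the X-letters, with zero differential) is $P_R(t,q)=\sum_i t^{F(x_i)}q^{M(x_i)}$. **Corollary.** Let $\langle X,Y\mid R\rangle$ be a pseudo-geometric presentation of $\pi_1(S^3\setminus K)$ for a $(1,1)$ knot $K$ in $S^3$. Then the absolute gradings $F$ and $M$ exist, and for any choices made in the deletion process $$P_R(t,-1)=\Delta_K(t).$$ -/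

import Mathlib

open scoped LaurentPolynomial

namespace OneOneKnot

/-! ## `(1,1)` knots in the three-sphere -/

/-- The three-sphere, as the unit sphere of `ℝ⁴`. -/
abbrev S3 : Type := Metric.sphere (0 : EuclideanSpace ℝ (Fin 4)) 1

/-- The closed unit disk. -/
abbrev Disk : Type := Metric.closedBall (0 : ℂ) 1

/-- A (tame) knot: the core of an open solid torus embedded in the three-sphere. -/
def IsKnot (K : Set S3) : Prop :=
  ∃ f : Circle × ℂ → S3, Topology.IsOpenEmbedding f ∧ f '' {p | p.2 = 0} = K

/-- `V` is a solid torus (a genus one handlebody) with boundary surface `T`. -/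
def IsSolidTorus (V T : Set S3) : Prop :=
  ∃ e : (Disk × Circle) ≃ₜ V, ∀ p, (e p : S3) ∈ T ↔ ‖(p.1 : ℂ)‖ = 1

/-- `γ` is a trivial arc of the handlebody `V` with boundary `T`: there is an embedded disk `D` in
`V` with `γ ⊆ ∂D` and `∂D ∩ T = ∂D ∖ Int γ`. The disk is parametrized so that `γ` is the upper
closed half of its boundary circle. -/
def IsTrivialArc (V T γ : Set S3) : Prop :=
  ∃ d : Disk → S3, Topology.IsEmbedding d ∧ Set.range d ⊆ V ∧
    γ = d '' {u | ‖(u : ℂ)‖ = 1 ∧ 0 ≤ (u : ℂ).im} ∧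
    ∀ u : Disk, ‖(u : ℂ)‖ = 1 → (d u ∈ T ↔ (u : ℂ).im ≤ 0)

/-- `K` is a `(1,1)` knot in `S³`: for some genus one Heegaard splitting `S³ = V₁ ∪ V₂`, the
intersection of `K` with each of the two solid tori is a single trivial arc. -/
def IsOneOneKnot (K : Set S3) : Prop :=
  IsKnot K ∧ ∃ V₁ V₂ : Set S3, V₁ ∪ V₂ = Set.univ ∧
    IsSolidTorus V₁ (V₁ ∩ V₂) ∧ IsSolidTorus V₂ (V₁ ∩ V₂) ∧
    IsTrivialArc V₁ (V₁ ∩ V₂) (K ∩ V₁) ∧ IsTrivialArc V₂ (V₁ ∩ V₂) (K ∩ V₂)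

/-- The knot group `π₁(S³ ∖ K, x)`. -/
abbrev KnotGroup (K : Set S3) (x : (Kᶜ : Set S3)) : Type := FundamentalGroup (Kᶜ : Set S3) x

/-! ## The Alexander polynomial -/

section Alexander

variable {G : Type*} [Group G]

/-- The Alexander module `C / [C, C]` of a group `G`, where `C = [G, G]`, written additively; it is
a `ℤ[t, t⁻¹]`-module once an element `g` of `G` is chosen (`t` acts by `c ↦ g⁻¹ c g`). -/
def AlexanderModule (_g : G) : Type _ := Additive (Abelianization (commutator G))

noncomputable instance (g : G) : AddCommGroup (AlexanderModule g) :=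
  inferInstanceAs (AddCommGroup (Additive (Abelianization (commutator G))))

/-- The automorphism of the Alexander module induced by `c ↦ g⁻¹ c g`. -/
noncomputable def tAction (g : G) : AlexanderModule g ≃ₗ[ℤ] AlexanderModule g :=
  (MulEquiv.toAdditive
    (MulAut.conjNormal (H := commutator G) g⁻¹).abelianizationCongr).toIntLinearEquiv

/-- The ring homomorphism `ℤ[t, t⁻¹] → End (C / [C, C])` that sends `t` to `tAction g`. -/
noncomputable def laurentAction (g : G) : ℤ[T;T⁻¹] →+* Module.End ℤ (AlexanderModule g) :=
  (AddMonoidAlgebra.lift ℤ (Module.End ℤ (AlexanderModule g)) ℤ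
    ((Units.coeHom _).comp
      (zpowersHom _ (LinearMap.GeneralLinearGroup.ofLinearEquiv (tAction g))))).toRingHom

noncomputable instance (g : G) : Module ℤ[T;T⁻¹] (AlexanderModule g) :=
  Module.compHom (AlexanderModule g) (laurentAction g)

/-- The value at `t = 1` of a Laurent polynomial. -/
noncomputable def evalOne : ℤ[T;T⁻¹] →+* ℤ := LaurentPolynomial.eval₂ (RingHom.id ℤ) 1

/-- `Δ` is the symmetrized Alexander polynomial of a knot with group `G`: the abelianization of `G`
is infinite cyclic, generated by the class of some `g`, the Alexander module (the first homology of
the infinite cyclic cover) is isomorphic to `ℤ[t, t⁻¹] / (Δ)`, and `Δ` is normalized by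
`Δ(t⁻¹) = Δ(t)` and `Δ(1) = 1`. (The Alexander module is cyclic for every `(1,1)` knot.) -/
def IsAlexanderPolynomial (G : Type*) [Group G] (Δ : ℤ[T;T⁻¹]) : Prop :=
  (∃ g : G, Function.Bijective (fun n : ℤ => (Abelianization.of g) ^ n) ∧
    Nonempty (AlexanderModule g ≃ₗ[ℤ[T;T⁻¹]] (ℤ[T;T⁻¹] ⧸ Ideal.span {Δ}))) ∧
  LaurentPolynomial.invert Δ = Δ ∧ evalOne Δ = 1

end Alexander

/-! ## Relators -/

/-- The two generators. -/
inductive Gen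
  | X
  | Y

/-- A word in `X, X⁻¹, Y, Y⁻¹`; `(X, true)` is `X` and `(X, false)` is `X⁻¹`. -/
abbrev Word : Type := List (Gen × Bool)

/-- The group `⟨X, Y | R⟩`. -/
abbrev PresGroup (R : Word) : Type := PresentedGroup {FreeGroup.mk R}

/-- The exponent of a letter. -/
def sgn (b : Bool) : ℤ := if b then 1 else -1

/-- The exponent sum of the `Y`-letters of a word before its first `X`-letter; `e` is added if there
is no `X`-letter. -/
def yRun (e : ℤ) : Word → ℤ
  | [] => e
  | (Gen.X, _) :: _ => 0
  | (Gen.Y, b) :: w => sgn b + yRun e w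

/-- The list of the `X`-letters of a word: for each of them its exponent and the exponent of the
power of `Y` between it and the next `X`-letter; `e` is added for the last one. -/
def syllablesAux (e : ℤ) : Word → List (ℤ × ℤ)
  | [] => []
  | (Gen.X, b) :: w => (sgn b, yRun e w) :: syllablesAux e w
  | (Gen.Y, _) :: w => syllablesAux e w

/-- The same list for a cyclic word: `R` is, up to a cyclic permutation,
`X^ε₀ Y^κ₀ X^ε₁ Y^κ₁ ⋯` with `[(ε₀, κ₀), (ε₁, κ₁), …]` the value at `R`. -/
def syllables (R : Word) : List (ℤ × ℤ) := syllablesAux (yRun 0 R) R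

/-- The number of `X`-letters (`X` or `X⁻¹`). They are labelled `0, …, numX R - 1` in order. -/
def numX (R : Word) : ℕ := (syllables R).length

/-- The exponent `±1` of the `i`-th `X`-letter of the cyclic word `R`, periodic in `i`. -/
def eps (R : Word) (i : ℕ) : ℤ := ((syllables R).getD (i % numX R) 0).1

/-- The exponent of the power of `Y` between the `i`-th `X`-letter and the next one, in the cyclic
word `R`; periodic in `i`. -/
def kap (R : Word) (i : ℕ) : ℤ := ((syllables R).getD (i % numX R) 0).2

/-- Quasi-geometric presentations. -/
structure IsQuasiGeometric (R : Word) : Prop where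
  /-- `R` is cyclically reduced. -/
  reduced : FreeGroup.IsCyclicallyReduced R
  /-- The exponent sum of `X` is `1`. -/
  sum_eps : ∑ i ∈ Finset.range (numX R), eps R i = 1
  /-- Cyclic subwords `X Y^k X⁻¹` and `X⁻¹ Y^k X` have `|k| = 1`. -/
  opposite : ∀ i, eps R (i + 1) = -eps R i → |kap R i| = 1
  /-- For cyclic subwords `X Y^l X` or `X⁻¹ Y^(-l) X⁻¹`, and `X Y^l' X` or `X⁻¹ Y^(-l') X⁻¹`, one has
  `|l - l'| ≤ 1`. -/
  same : ∀ i j, eps R (i + 1) = eps R i → eps R (j + 1) = eps R j →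
    |eps R i * kap R i - eps R j * kap R j| ≤ 1

/-! ## Disk words

A sequence `ε` gives the exponents of successive `X`-letters and `κ` the exponents of the powers of
`Y` that separate them. The subword from the `a`-th to the `b`-th `X`-letter is `(a, b)`. -/

/-- The number of letters `X` minus the number of letters `X⁻¹` in the subword `(a, i)`. -/
def phi (ε : ℕ → ℤ) (a i : ℕ) : ℤ := ∑ k ∈ Finset.Icc a i, ε k

/-- `(a, b)` is a primitive disk word. (The value `0` of `ε` stands for an erased letter.) -/
def IsPrimitiveDiskWord (ε : ℕ → ℤ) (a b : ℕ) : Prop :=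
  a < b ∧ ε a ≠ 0 ∧ ε b = -ε a ∧ phi ε a b = 0 ∧ ∀ k, a < k → k < b → phi ε a k ≠ 0

/-- The sum of the orientations of the elementary disk words contained in `(a, b)`: the words
`X Y⁻¹ X⁻¹` and `X⁻¹ Y X` are positive, `X Y X⁻¹` and `X⁻¹ Y⁻¹ X` are negative. -/
def orientation (ε κ : ℕ → ℤ) (a b : ℕ) : ℤ :=
  ∑ i ∈ Finset.Ico a b, if ε (i + 1) = -ε i then
    (if (ε i = 1 ∧ κ i = -1) ∨ (ε i = -1 ∧ κ i = 1) then 1 else -1) else 0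

/-- A disk word is positive if it contains more positive than negative elementary disk words (and
negative otherwise; the numbers differ for primitive disk words). -/
def IsPositive (ε κ : ℕ → ℤ) (a b : ℕ) : Prop := 0 < orientation ε κ a b

instance (ε κ : ℕ → ℤ) (a b : ℕ) : Decidable (IsPositive ε κ a b) :=
  inferInstanceAs (Decidable (0 < _))

/-- The height of the `i`-th `X`-letter in an upward disk word that starts at `a`. -/
def height (ε : ℕ → ℤ) (a i : ℕ) : ℤ := phi ε a i - if ε i = ε a then 1 else 0

/-- The subwords of `(a, b)` between two consecutive `X`-letters of height one. -/
def pieces (ε : ℕ → ℤ) (a b : ℕ) : Finset (ℕ × ℕ) :=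
  (Finset.Ioo a b ×ˢ Finset.Ioo a b).filter fun p =>
    p.1 < p.2 ∧ height ε a p.1 = 1 ∧ height ε a p.2 = 1 ∧
      ∀ k ∈ Finset.Ioo p.1 p.2, height ε a k ≠ 1

/-- The pair `(n_z, n_w)` of an elementary disk word. -/
def elementaryP (e k : ℤ) : ℤ × ℤ :=
  if e = 1 then (if k = 1 then (0, -1) else (0, 1))
  else (if k = 1 then (1, 0) else (-1, 0))

/-- The pair `P(S)` for an upward positive primitive disk word
`(a, b) = X Y^l X ⋯ X⁻¹ Y^(-l') X⁻¹` that is not elementary. -/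
def squareP (ε κ : ℕ → ℤ) (a b : ℕ) : ℤ × ℤ :=
  let l := κ a
  let l' := -κ (b - 1)
  if l = l' + 1 then (1, 0)
  else if l' = l + 1 then (0, 1)
  else if 2 ≤ (pieces ε a b).card ∧
      ∀ p ∈ pieces ε a b, p.1 = a + 1 ∨ p.2 = b - 1 → IsPositive ε κ p.1 p.2 then (1, 1)
  else (0, 0)

/-- The pair `P = (n_z, n_w)` of the primitive disk word `(a, b)`. -/
def basepoints (ε κ : ℕ → ℤ) (a b : ℕ) : ℤ × ℤ :=
  -- the value if the word with exponents `ε'`, `κ'` is upward and positive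
  let core : (ℕ → ℤ) → (ℕ → ℤ) → ℤ × ℤ := fun ε' κ' =>
    squareP ε' κ' a b + ∑ p ∈ (pieces ε' a b).attach, basepoints ε' κ' p.1.1 p.1.2
  if b = a + 1 then elementaryP (ε a) (κ a)
  else if ε a = 1 then
    if IsPositive ε κ a b then core ε κ
    else -core ε (-κ)
  else
    if IsPositive ε κ a b then (core (-ε) (-κ)).swap
    else -(core (-ε) κ).swap
termination_by b - a
decreasing_by
  all_goals
    have h := p.2
    simp only [pieces, Finset.mem_filter, Finset.mem_product, Finset.mem_Ioo] at h
    omega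

/-- The number `n_z` of a primitive disk word of the cyclic word `R`. -/
def nz (R : Word) (a b : ℕ) : ℤ := (basepoints (eps R) (kap R) a b).1

/-- The number `n_w` of a primitive disk word of the cyclic word `R`. -/
def nw (R : Word) (a b : ℕ) : ℤ := (basepoints (eps R) (kap R) a b).2

/-! ## Gradings

A grading is a function on the labels `0, …, numX R - 1` of the `X`-letters (its values at other
numbers play no role). -/

/-- `F` is a relative Alexander grading. -/
def IsRelAlexander (R : Word) (F : ℕ → ℤ) : Prop :=
  ∀ a b, IsPrimitiveDiskWord (eps R) a b →
    F (a % numX R) - F (b % numX R) = nz R a b - nw R a b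

/-- `M` is a relative Maslov grading. -/
def IsRelMaslov (R : Word) (M : ℕ → ℤ) : Prop :=
  ∀ a b, IsPrimitiveDiskWord (eps R) a b →
    M (a % numX R) - M (b % numX R) =
      (if IsPositive (eps R) (kap R) a b then 1 else -1) - 2 * nw R a b

/-- `w` is a relative `w`-grading. -/
def IsRelW (R : Word) (w : ℕ → ℤ) : Prop :=
  ∀ a b, IsPrimitiveDiskWord (eps R) a b → w (a % numX R) - w (b % numX R) = nw R a b

/-- `F` is an absolute Alexander grading: a relative one with
`#{x | F x = s} ≡ #{x | F x = -s} mod 2` for all `s`. -/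
def IsAlexanderGrading (R : Word) (F : ℕ → ℤ) : Prop :=
  IsRelAlexander R F ∧ ∀ s : ℤ,
    ((Finset.range (numX R)).filter fun i => F i = s).card ≡
      ((Finset.range (numX R)).filter fun i => F i = -s).card [MOD 2]

/-! ## Deleting disk words

The state of the deletion process is the set of the labels of the remaining `X`-letters. -/

/-- The exponents of the `X`-letters when only the letters with labels in `S` remain. -/
def epsOn (R : Word) (S : Finset ℕ) (i : ℕ) : ℤ := if i % numX R ∈ S then eps R i else 0

/-- What remains of `S` when the cyclic subword `(a, b)` of `R` is deleted. -/
def erase (R : Word) (S : Finset ℕ) (a b : ℕ) : Finset ℕ :=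
  S \ (Finset.Icc a b).image (· % numX R)

/-- First procedure, one step: a primitive disk word of `R` with `n_w = 0`, whose two ends are still
present, is deleted. -/
def FirstStep (R : Word) (S S' : Finset ℕ) : Prop :=
  ∃ a b, IsPrimitiveDiskWord (eps R) a b ∧ nw R a b = 0 ∧
    a % numX R ∈ S ∧ b % numX R ∈ S ∧ S' = erase R S a b

/-- Second procedure, one step: a primitive disk word of the current relator is deleted whose two
ends have the same `w`-grading, where `w` is the grading of the original relator `R`. -/
def SecondStep (R : Word) (w : ℕ → ℤ) (S S' : Finset ℕ) : Prop :=
  ∃ a b, IsPrimitiveDiskWord (epsOn R S) a b ∧ w (a % numX R) = w (b % numX R) ∧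
    S' = erase R S a b

/-- The two procedures, the first one carried out until it cannot be continued, can be carried out
so that the `k`-th letter is the only `X`-letter that is left. -/
def IsSurvivor (R : Word) (k : ℕ) : Prop :=
  ∃ (w : ℕ → ℤ) (S : Finset ℕ), IsRelW R w ∧
    Relation.ReflTransGen (FirstStep R) (Finset.range (numX R)) S ∧
    (∀ S', ¬ FirstStep R S S') ∧
    Relation.ReflTransGen (SecondStep R w) S {k}

/-- `M` is an absolute Maslov grading: a relative one that vanishes at a letter which is left alone
by the deletion process. -/
def IsMaslovGrading (R : Word) (M : ℕ → ℤ) : Prop :=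
  IsRelMaslov R M ∧ ∃ k, IsSurvivor R k ∧ M k = 0

/-- Pseudo-geometric presentations. -/
structure IsPseudoGeometric (R : Word) : Prop extends IsQuasiGeometric R where
  /-- The relative Alexander grading can be normalized. -/
  alexander : ∃ F, IsAlexanderGrading R F
  /-- The deletion process leaves exactly one `X`-letter. -/
  survivor : ∃ k, IsSurvivor R k

/-! ## The Poincaré polynomial -/

/-- `∑ t^F(x) q^M(x)` over the `X`-letters `x`, a Laurent polynomial in `q` over `ℤ[t, t⁻¹]`. It is
the Poincaré polynomial of the free complex on the `X`-letters with zero differential. -/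
noncomputable def poincare (R : Word) (F M : ℕ → ℤ) : ℤ[T;T⁻¹][T;T⁻¹] :=
  ∑ i ∈ Finset.range (numX R),
    LaurentPolynomial.C (LaurentPolynomial.T (F i)) * LaurentPolynomial.T (M i)

/-- `P` is the Poincaré polynomial that the algorithm produces from `R`. -/
def IsPoincarePolynomial (R : Word) (P : ℤ[T;T⁻¹][T;T⁻¹]) : Prop :=
  ∃ F M, IsAlexanderGrading R F ∧ IsMaslovGrading R M ∧ P = poincare R F M

/-- The substitution `P(t, q) ↦ P(t, -1)`. -/
noncomputable def evalNegOne : ℤ[T;T⁻¹][T;T⁻¹] →+* ℤ[T;T⁻¹] :=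
  LaurentPolynomial.eval₂ (RingHom.id _) (-1)

end OneOneKnot

open OneOneKnot

/-!
The topology of the knot enters only through its group, and the proof compares the combinatorial
gradings with Fox calculus.

*One chain of letters.* Read the exponents of the `X`-letters as the steps of a walk on `ℤ`. The
two ends of a primitive disk word are consecutive letters that cross the same edge of `ℤ`
(`isPrimitiveDiskWord_iff_level`). As the exponent sum of `R` is `1`, moving once around `R` raises
the edge by one, so every letter of `R` has exactly one translate on a given edge. Hence the letters
of `R` form a single chain linked by primitive disk words: relative gradings exist
(`exists_potential`) and are unique up to a constant (`eq_of_forall_primitiveDiskWord`).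

*The Alexander grading.* Induction along the recursive definition gives that `n_z - n_w` of a
primitive disk word is the exponent sum of its `Y`-letters (`basepoints_fst_sub_snd`): the square
`S` contributes exactly the difference `l - l'` of the two outermost powers of `Y`. Thus `F` is, up
to a constant, minus the exponent of the monomial that the letter contributes to the Fox derivative
of `R` by `X` (`IsRelAlexander.exists_eq`).

*The Maslov grading.* Both the parity of `M` and the exponent of the letter change at each link of
the chain. Each deletion removes letters of total exponent zero, so the surviving letter, where
`M = 0`, has exponent `1` (`IsSurvivor.lt_numX_and_eps_eq_one`) and `(-1) ^ M` is the exponent.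

So `P_R(t, -1)` is a sum of terms `± t ^ F` that equals the Fox derivative up to a unit and
inversion of `t`. The Fox derivative generates the annihilator of the Alexander module
(`fox_dvd_and_dvd_fox`): it kills the class of `X Y ^ m`, which generates the module, and the group
acts by affine permutations of the quotient of `ℤ[t, t⁻¹]` by it, which bounds the annihilator from
above. Finally, the unit is `1`: its sign is determined by the value at `t = 1`, and its degree by
the symmetry modulo two that normalizes `F` (`eq_of_dvd_of_symmetric_modTwo`).
-/

namespace OneOneKnot

open LaurentPolynomial (T)

/-! ### Levels of the letters and relative gradings -/

section Levels

variable {ε : ℕ → ℤ} {N : ℕ}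

/-- The sum of the exponents of the letters before the `i`-th one. -/
def psum (ε : ℕ → ℤ) (i : ℕ) : ℤ := ∑ k ∈ Finset.range i, ε k

theorem psum_succ (ε : ℕ → ℤ) (i : ℕ) : psum ε (i + 1) = psum ε i + ε i :=
  Finset.sum_range_succ _ _

theorem phi_eq_psum (ε : ℕ → ℤ) {a i : ℕ} (h : a ≤ i + 1) :
    phi ε a i = psum ε (i + 1) - psum ε a := by
  unfold phi psum
  rw [← Finset.sum_Ico_eq_sub _ h]
  rfl

theorem psum_add_period (hε : ∀ i, ε (i + N) = ε i) (hN : psum ε N = 1) (i : ℕ) :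
    psum ε (i + N) = psum ε i + 1 := by
  induction i with
  | zero => rw [Nat.zero_add, hN]; simp [psum]
  | succ i ih => rw [Nat.add_right_comm, psum_succ, psum_succ, ih, hε]; ring

/-- The level of a letter: the lower one of the two partial sums that it joins. -/
def level (ε : ℕ → ℤ) (i : ℕ) : ℤ := min (psum ε i) (psum ε (i + 1))

theorem level_add_period (hε : ∀ i, ε (i + N) = ε i) (hN : psum ε N = 1) (i : ℕ) :
    level ε (i + N) = level ε i + 1 := by
  unfold level
  rw [Nat.add_right_comm, psum_add_period hε hN, psum_add_period hε hN, min_add_add_right]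

theorem level_add_mul_period (hε : ∀ i, ε (i + N) = ε i) (hN : psum ε N = 1) (i t : ℕ) :
    level ε (i + N * t) = level ε i + t := by
  induction t with
  | zero => simp
  | succ t ih =>
    rw [Nat.mul_succ, ← Nat.add_assoc, level_add_period hε hN, ih]; push_cast; ring

/-- In a primitive disk word the partial sums stay strictly on one side of the initial one. -/
theorem IsPrimitiveDiskWord.one_le_mul_psum (hε : ∀ i, ε i = 1 ∨ ε i = 0 ∨ ε i = -1) {a b : ℕ}
    (h : IsPrimitiveDiskWord ε a b) {k : ℕ} (hak : a ≤ k) (hkb : k < b) :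
    1 ≤ ε a * (psum ε (k + 1) - psum ε a) := by
  obtain ⟨hab, ha, hb, h0, hne⟩ := h
  induction k, hak using Nat.le_induction with
  | base =>
    rw [psum_succ]
    rcases hε a with h | h | h <;> simp_all
  | succ k hk ih =>
    have h1 := ih (by omega)
    have h2 := hne (k + 1) (by omega) hkb
    rw [phi_eq_psum _ (by omega)] at h2
    rw [psum_succ ε (k + 1)] at h2 ⊢
    rcases hε a with h | h | h <;> rcases hε (k + 1) with h' | h' | h' <;> rw [h] at h1 ⊢ <;>
      rw [h'] at h2 ⊢ <;> omega

theorem IsPrimitiveDiskWord.psum_eq {a b : ℕ}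
    (h : IsPrimitiveDiskWord ε a b) : psum ε (b + 1) = psum ε a := by
  have h0 := h.2.2.2.1
  rw [phi_eq_psum _ (by have := h.1; omega)] at h0
  omega

/-- A primitive disk word is shorter than the period. -/
theorem IsPrimitiveDiskWord.lt_add_period (hε : ∀ i, ε i = 1 ∨ ε i = 0 ∨ ε i = -1)
    (hp : ∀ i, ε (i + N) = ε i) (hN : psum ε N = 1) {a b : ℕ}
    (h : IsPrimitiveDiskWord ε a b) : b < a + N := by
  by_contra! hlt
  have hne : b ≠ a + N := by
    rintro rfl
    have h2 := h.2.1
    have h3 := h.2.2.1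
    rw [hp] at h3
    omega
  have hN0 : 0 < N := by
    rcases Nat.eq_zero_or_pos N with h | h
    · simp [h, psum] at hN
    · exact h
  have hb := h.psum_eq
  rcases hε a with ha | ha | ha
  · have h1 := h.one_le_mul_psum hε (k := b - N) (by omega) (by omega)
    have h2 := psum_add_period hp hN (b - N + 1)
    rw [show b - N + 1 + N = b + 1 by omega] at h2
    rw [ha] at h1
    omega
  · exact h.2.1 ha
  · have h1 := h.one_le_mul_psum hε (k := a + N) (by omega) (by omega)
    have h2 := psum_add_period hp hN (a + 1)
    have h3 := psum_succ ε a
    rw [show a + 1 + N = a + N + 1 by omega] at h2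
    rw [ha] at h1 h3
    omega

theorem IsPrimitiveDiskWord.level_eq {a b : ℕ}
    (h : IsPrimitiveDiskWord ε a b) : level ε a = level ε b := by
  have h1 := h.psum_eq
  have h2 := h.2.2.1
  have h3 := psum_succ ε a
  have h4 := psum_succ ε b
  unfold level
  omega

theorem IsPrimitiveDiskWord.level_ne (hε : ∀ i, ε i = 1 ∨ ε i = -1) {a b k : ℕ}
    (h : IsPrimitiveDiskWord ε a b) (hak : a < k) (hkb : k < b) : level ε k ≠ level ε a := by
  have hε' : ∀ i, ε i = 1 ∨ ε i = 0 ∨ ε i = -1 := fun i => (hε i).imp_right Or.inr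
  have h1 := h.one_le_mul_psum hε' hak.le hkb
  have h2 := h.one_le_mul_psum hε' (k := k - 1) (by omega) (by omega)
  rw [show k - 1 + 1 = k by omega] at h2
  have h3 := psum_succ ε a
  have h4 := psum_succ ε k
  have h5 := hε k
  unfold level
  rcases hε a with h | h <;> rw [h] at h1 h2 h3 <;> omega

/-- Consecutive letters of the same level are the ends of a primitive disk word. -/
theorem isPrimitiveDiskWord_of_level (hε : ∀ i, ε i = 1 ∨ ε i = -1) {a b : ℕ} (hab : a < b)
    (hl : level ε a = level ε b) (hne : ∀ k, a < k → k < b → level ε k ≠ level ε a) :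
    IsPrimitiveDiskWord ε a b := by
  have key : ∀ k, a ≤ k → k < b → 1 ≤ ε a * (psum ε (k + 1) - psum ε a) := by
    intro k hak
    induction k, hak using Nat.le_induction with
    | base =>
      intro _
      rw [psum_succ]
      rcases hε a with h | h <;> simp [h]
    | succ k hk ih =>
      intro hkb
      have h1 := ih (by omega)
      have h2 := hne (k + 1) (by omega) hkb
      have h3 := psum_succ ε a
      have h4 := psum_succ ε (k + 1)
      unfold level at h2
      rcases hε a with h | h <;> rcases hε (k + 1) with h' | h' <;> rw [h] at h1 h3 ⊢ <;>
        rw [h'] at h4 <;> omega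
  have h1 := key (b - 1) (by omega) (by omega)
  rw [show b - 1 + 1 = b by omega] at h1
  have h3 := psum_succ ε a
  have h4 := psum_succ ε b
  unfold level at hl
  refine ⟨hab, by rcases hε a with h | h <;> simp [h], ?_, ?_, ?_⟩
  · rcases hε a with h | h <;> rcases hε b with h' | h' <;> rw [h] at h1 h3 ⊢ <;>
      rw [h'] at h4 ⊢ <;> omega
  · rw [phi_eq_psum _ (by omega)]
    rcases hε a with h | h <;> rcases hε b with h' | h' <;> rw [h] at h1 h3 <;>
      rw [h'] at h4 <;> omega
  · intro k hak hkb
    have := key k hak.le hkb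
    rw [phi_eq_psum _ (by omega)]
    intro h0
    simp [h0] at this

/-- A function that has the same value at the two ends of every primitive disk word is constant on
every level. -/
theorem eq_of_level_eq {α : Type*} (hε : ∀ i, ε i = 1 ∨ ε i = -1) {f : ℕ → α}
    (hf : ∀ a b, IsPrimitiveDiskWord ε a b → f a = f b) {i j : ℕ} (hij : i ≤ j)
    (h : level ε i = level ε j) : f i = f j := by
  induction j using Nat.strong_induction_on with
  | _ j ih =>
    rcases hij.eq_or_lt with rfl | hlt
    · rfl
    -- the last letter before the `j`-th one on the same level
    have hP : level ε i = level ε j ∧ i < j := ⟨h, hlt⟩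
    set k := Nat.findGreatest (fun k => level ε k = level ε j ∧ k < j) j with hk
    have hk1 : level ε k = level ε j ∧ k < j :=
      Nat.findGreatest_spec (P := fun k => level ε k = level ε j ∧ k < j) hij hP
    have hk2 : i ≤ k := Nat.le_findGreatest hij hP
    have hk3 : ∀ l, k < l → l < j → level ε l ≠ level ε k := by
      intro l h1 h2 h3
      exact Nat.findGreatest_is_greatest h1 h2.le ⟨h3.trans hk1.1, h2⟩
    rw [ih k hk1.2 hk2 (h.trans hk1.1.symm)]
    exact hf k j (isPrimitiveDiskWord_of_level hε hk1.2 hk1.1 hk3)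

/-- The values at the letters of a level that are obtained by adding up, from the first letter on,
the values of `-v` at the primitive disk words. -/
noncomputable def potential (ε : ℕ → ℤ) (v : ℕ → ℕ → ℤ) (i : ℕ) : ℤ :=
  open Classical in
  if h : ∃ k < i, IsPrimitiveDiskWord ε k i then potential ε v h.choose - v h.choose i else 0
termination_by i
decreasing_by exact h.choose_spec.1

theorem potential_sub (hε : ∀ i, ε i = 1 ∨ ε i = -1) (v : ℕ → ℕ → ℤ) {a b : ℕ}
    (h : IsPrimitiveDiskWord ε a b) : potential ε v a - potential ε v b = v a b := by
  have hex : ∃ k < b, IsPrimitiveDiskWord ε k b := ⟨a, h.1, h⟩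
  have huniq : hex.choose = a := by
    have h1 := hex.choose_spec.2
    rcases lt_trichotomy hex.choose a with hlt | heq | hlt
    · exact absurd ((h.level_eq).trans (h1.level_eq).symm) (h1.level_ne hε hlt h.1)
    · exact heq
    · exact absurd ((h1.level_eq).trans (h.level_eq).symm) (h.level_ne hε hlt h1.1)
  rw [potential.eq_1 ε v b, dif_pos hex, huniq]
  ring

theorem add_mul_period (hp : ∀ i, ε (i + N) = ε i) (i t : ℕ) : ε (i + N * t) = ε i := by
  induction t with
  | zero => simp
  | succ t ih => rw [Nat.mul_succ, ← Nat.add_assoc, hp, ih]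

theorem isPrimitiveDiskWord_iff_level (hε : ∀ i, ε i = 1 ∨ ε i = -1) {a b : ℕ} :
    IsPrimitiveDiskWord ε a b ↔
      a < b ∧ level ε a = level ε b ∧ ∀ k, a < k → k < b → level ε k ≠ level ε a :=
  ⟨fun h => ⟨h.1, h.level_eq, fun _ => h.level_ne hε⟩,
    fun h => isPrimitiveDiskWord_of_level hε h.1 h.2.1 h.2.2⟩

theorem isPrimitiveDiskWord_add_mul_period (hε : ∀ i, ε i = 1 ∨ ε i = -1)
    (hp : ∀ i, ε (i + N) = ε i) (hN : psum ε N = 1) (a b t : ℕ) :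
    IsPrimitiveDiskWord ε (a + N * t) (b + N * t) ↔ IsPrimitiveDiskWord ε a b := by
  simp only [isPrimitiveDiskWord_iff_level hε, level_add_mul_period hp hN]
  refine and_congr (by omega) (and_congr (by omega) ⟨fun h k h1 h2 => ?_, fun h k h1 h2 => ?_⟩)
  · have := h (k + N * t) (by omega) (by omega)
    rw [level_add_mul_period hp hN] at this
    omega
  · have := h (k - N * t) (by omega) (by omega)
    have h3 := level_add_mul_period hp hN (k - N * t) t
    rw [show k - N * t + N * t = k by omega] at h3
    omega

/-- A level above the levels of the first `N` letters. -/
noncomputable def topLevel (ε : ℕ → ℤ) (N : ℕ) : ℤ := ∑ i ∈ Finset.range N, |level ε i|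

/-- The letter of level `topLevel ε N` in the residue class of `i < N`. -/
noncomputable def topTranslate (ε : ℕ → ℤ) (N i : ℕ) : ℕ := i + N * (topLevel ε N - level ε i).toNat

theorem level_le_topLevel {i : ℕ} (hi : i < N) : level ε i ≤ topLevel ε N :=
  (le_abs_self _).trans (Finset.single_le_sum (f := fun i => |level ε i|)
    (fun _ _ => abs_nonneg _) (Finset.mem_range.2 hi))

theorem level_topTranslate (hp : ∀ i, ε (i + N) = ε i) (hN : psum ε N = 1) {i : ℕ} (hi : i < N) :
    level ε (topTranslate ε N i) = topLevel ε N := by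
  rw [topTranslate, level_add_mul_period hp hN,
    Int.toNat_of_nonneg (sub_nonneg.2 (level_le_topLevel hi))]
  ring

theorem period_pos (hN : psum ε N = 1) : 0 < N := by
  rcases Nat.eq_zero_or_pos N with h | h
  · simp [h, psum] at hN
  · exact h

/-- Letters of a cyclic word whose exponent sum is `1` are linked by primitive disk words: a
translation by the period raises the level by one, so that every letter has exactly one translate on
a given level. -/
theorem eq_of_forall_primitiveDiskWord {α : Type*} (hε : ∀ i, ε i = 1 ∨ ε i = -1)
    (hp : ∀ i, ε (i + N) = ε i) (hN : psum ε N = 1) {f : ℕ → α}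
    (hf : ∀ a b, IsPrimitiveDiskWord ε a b → f (a % N) = f (b % N)) {i j : ℕ}
    (hi : i < N) (hj : j < N) : f i = f j := by
  have h : ∀ {i j}, i < N → j < N → topTranslate ε N i ≤ topTranslate ε N j → f i = f j := by
    intro i j hi hj hle
    have := eq_of_level_eq hε (f := fun i => f (i % N)) hf hle
      (by rw [level_topTranslate hp hN hi, level_topTranslate hp hN hj])
    simpa [topTranslate, Nat.mod_eq_of_lt hi, Nat.mod_eq_of_lt hj] using this
  rcases le_total (topTranslate ε N i) (topTranslate ε N j) with hle | hle
  · exact h hi hj hle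
  · exact (h hj hi hle).symm

/-- The translate on the top level of the residue class of any letter `a` differs from `a` by a
multiple of the period; the two cases avoid a negative multiple. -/
theorem topTranslate_mod (hp : ∀ i, ε (i + N) = ε i) (hN : psum ε N = 1) (a : ℕ) :
    (level ε a ≤ topLevel ε N →
      topTranslate ε N (a % N) = a + N * (topLevel ε N - level ε a).toNat) ∧
    (topLevel ε N ≤ level ε a →
      a = topTranslate ε N (a % N) + N * (level ε a - topLevel ε N).toNat) := by
  have h1 := level_add_mul_period hp hN (a % N) (a / N)
  have h2 := Nat.mod_add_div a N
  have h3 := level_le_topLevel (ε := ε) (Nat.mod_lt a (period_pos hN))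
  rw [h2] at h1
  constructor <;> intro h
  · have : (topLevel ε N - level ε (a % N)).toNat
      = a / N + (topLevel ε N - level ε a).toNat := by omega
    rw [topTranslate, this, Nat.mul_add]
    omega
  · have : a / N = (topLevel ε N - level ε (a % N)).toNat
      + (level ε a - topLevel ε N).toNat := by omega
    rw [this, Nat.mul_add] at h2
    rw [topTranslate]
    omega

/-- Relative gradings exist: a periodic function of primitive disk words is the difference of the
values of a function of the letters at their ends. -/
theorem exists_potential (hε : ∀ i, ε i = 1 ∨ ε i = -1)
    (hp : ∀ i, ε (i + N) = ε i) (hN : psum ε N = 1) {v : ℕ → ℕ → ℤ}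
    (hv : ∀ a b t, v (a + N * t) (b + N * t) = v a b) :
    ∃ f : ℕ → ℤ, ∀ a b, IsPrimitiveDiskWord ε a b → f (a % N) - f (b % N) = v a b := by
  refine ⟨fun i => potential ε v (topTranslate ε N i), fun a b h => ?_⟩
  have hl := h.level_eq
  have ha := topTranslate_mod hp hN a
  have hb := topTranslate_mod hp hN b
  rcases le_total (level ε a) (topLevel ε N) with hle | hle
  · simp only
    rw [ha.1 hle, hb.1 (hl ▸ hle), ← hl, potential_sub hε, hv]
    rwa [isPrimitiveDiskWord_add_mul_period hε hp hN]
  · have h1 := ha.2 hle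
    have h2 := hb.2 (hl ▸ hle)
    rw [← hl] at h2
    simp only
    rw [potential_sub hε, ← hv _ _ (level ε a - topLevel ε N).toNat, ← h1, ← h2]
    rwa [← isPrimitiveDiskWord_add_mul_period hε hp hN _ _ (level ε a - topLevel ε N).toNat,
      ← h1, ← h2]

end Levels

/-! ### Basepoint numbers -/

section Basepoints

/-- The conditions on exponent sequences that a quasi-geometric relator satisfies. -/
structure IsTame (ε κ : ℕ → ℤ) : Prop where
  unit : ∀ i, ε i = 1 ∨ ε i = -1
  opposite : ∀ i, ε (i + 1) = -ε i → |κ i| = 1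
  same : ∀ i j, ε (i + 1) = ε i → ε (j + 1) = ε j → |ε i * κ i - ε j * κ j| ≤ 1

variable {ε κ : ℕ → ℤ}

theorem IsTame.neg_left (h : IsTame ε κ) : IsTame (-ε) κ where
  unit i := by have := h.unit i; simp only [Pi.neg_apply]; omega
  opposite i hi := h.opposite i (neg_injective hi)
  same i j hi hj := by
    have := h.same i j (neg_injective hi) (neg_injective hj)
    rw [← abs_neg]
    convert this using 2
    simp only [Pi.neg_apply]
    ring

theorem IsTame.neg_right (h : IsTame ε κ) : IsTame ε (-κ) where
  unit := h.unit
  opposite i hi := by simpa using h.opposite i hi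
  same i j hi hj := by
    have := h.same i j hi hj
    rw [← abs_neg]
    convert this using 2
    simp only [Pi.neg_apply]
    ring

theorem IsPrimitiveDiskWord.neg {a b : ℕ} (h : IsPrimitiveDiskWord ε a b) :
    IsPrimitiveDiskWord (-ε) a b := by
  have hphi : ∀ k, phi (-ε) a k = -phi ε a k := fun k => by simp [phi]
  obtain ⟨h1, h2, h3, h4, h5⟩ := h
  exact ⟨h1, by simpa using h2, by simp [h3], by rw [hphi, h4, neg_zero],
    fun k hk hk' => by rw [hphi, neg_ne_zero]; exact h5 k hk hk'⟩

theorem height_eq_level (hε : ∀ i, ε i = 1 ∨ ε i = -1) {a i : ℕ} (ha : ε a = 1) (hi : a ≤ i) :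
    height ε a i = level ε i - level ε a := by
  rw [height, phi_eq_psum _ (by omega), ha]
  have h1 := psum_succ ε i
  have h2 := psum_succ ε a
  unfold level
  split_ifs with h
  · omega
  · have := hε i
    omega

theorem mem_pieces {a b : ℕ} {p : ℕ × ℕ} : p ∈ pieces ε a b ↔
    (a < p.1 ∧ p.2 < b ∧ p.1 < p.2) ∧ height ε a p.1 = 1 ∧ height ε a p.2 = 1 ∧
      ∀ k, p.1 < k → k < p.2 → height ε a k ≠ 1 := by
  simp only [pieces, Finset.mem_filter, Finset.mem_product, Finset.mem_Ioo]
  constructor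
  · rintro ⟨h1, h2, h3, h4, h5⟩
    exact ⟨by omega, h3, h4, fun k hk hk' => h5 k ⟨hk, hk'⟩⟩
  · rintro ⟨h1, h3, h4, h5⟩
    exact ⟨by omega, by omega, h3, h4, fun k hk => h5 k hk.1 hk.2⟩

theorem isPrimitiveDiskWord_of_mem_pieces (hε : ∀ i, ε i = 1 ∨ ε i = -1) {a b : ℕ} (ha : ε a = 1)
    {p : ℕ × ℕ} (hp : p ∈ pieces ε a b) : IsPrimitiveDiskWord ε p.1 p.2 := by
  rw [mem_pieces] at hp
  obtain ⟨⟨h1, h2, h3⟩, h4, h5, h6⟩ := hp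
  rw [height_eq_level hε ha (by omega)] at h4 h5
  refine isPrimitiveDiskWord_of_level hε h3 (by omega) fun k hk hk' => ?_
  have := h6 k hk hk'
  rw [height_eq_level hε ha (by omega)] at this
  omega

/-- The pieces of an upward primitive disk word `X Y^l ⋯ Y^(-l') X⁻¹` cover its interior. -/
theorem sum_pieces {a b : ℕ} (h1 : height ε a (a + 1) = 1) (h2 : height ε a (b - 1) = 1)
    (f : ℕ → ℤ) :
    ∑ p ∈ pieces ε a b, ∑ i ∈ Finset.Ico p.1 p.2, f i = ∑ i ∈ Finset.Ico (a + 1) (b - 1), f i := by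
  rw [← Finset.sum_biUnion]
  · refine Finset.sum_congr ?_ fun _ _ => rfl
    ext i
    simp only [Finset.mem_biUnion, Finset.mem_Ico, mem_pieces]
    constructor
    · rintro ⟨p, hp, hi⟩
      omega
    · rintro ⟨hi, hi'⟩
      -- the last letter of height one up to `i`, and the first one after `i`
      set u := Nat.findGreatest (fun k => a < k ∧ height ε a k = 1) i with hu
      have hu1 : a < u ∧ height ε a u = 1 :=
        Nat.findGreatest_spec (P := fun k => a < k ∧ height ε a k = 1) hi ⟨by omega, h1⟩
      have hu2 : u ≤ i := Nat.findGreatest_le i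
      have hu3 : ∀ k, u < k → k ≤ i → height ε a k ≠ 1 := fun k hk hk' h =>
        Nat.findGreatest_is_greatest hk hk' ⟨by omega, h⟩
      have hex : ∃ k, i < k ∧ height ε a k = 1 := ⟨b - 1, hi', h2⟩
      classical
      have hv1 := Nat.find_spec hex
      have hv2 : Nat.find hex ≤ b - 1 := Nat.find_min' hex ⟨hi', h2⟩
      refine ⟨(u, Nat.find hex), ⟨⟨hu1.1, by simp only; omega, by simp only; omega⟩, hu1.2, hv1.2,
        fun k hk hk' h => ?_⟩, hu2, hv1.1⟩
      by_cases hki : k ≤ i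
      · exact hu3 k hk hki h
      · exact Nat.find_min hex hk' ⟨by omega, h⟩
  · intro p hp q hq hpq
    rw [Finset.mem_coe, mem_pieces] at hp hq
    rw [Function.onFun, Finset.disjoint_left]
    intro i hi hi'
    rw [Finset.mem_Ico] at hi hi'
    obtain ⟨_, p1, p2, p3⟩ := hp
    obtain ⟨_, q1, q2, q3⟩ := hq
    apply hpq
    ext
    · rcases lt_trichotomy p.1 q.1 with h | h | h
      · exact absurd q1 (p3 _ h (by omega))
      · exact h
      · exact absurd p1 (q3 _ h (by omega))
    · rcases lt_trichotomy p.2 q.2 with h | h | h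
      · exact absurd p2 (q3 _ (by omega) h)
      · exact h
      · exact absurd q2 (p3 _ (by omega) h)

theorem squareP_fst_sub_snd {a b : ℕ} (h : |κ a + κ (b - 1)| ≤ 1) :
    (squareP ε κ a b).1 - (squareP ε κ a b).2 = κ a + κ (b - 1) := by
  rw [abs_le] at h
  unfold squareP
  simp only
  split_ifs <;> simp only <;> omega

/-- The step of the recursion for `n_z - n_w`, for an upward disk word. -/
theorem squareP_add_sum_pieces (h : IsTame ε κ) {a b : ℕ} (hab : b ≠ a + 1)
    (hw : IsPrimitiveDiskWord ε a b) (ha : ε a = 1)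
    (ih : ∀ p ∈ pieces ε a b, (basepoints ε κ p.1 p.2).1 - (basepoints ε κ p.1 p.2).2 =
      ∑ i ∈ Finset.Ico p.1 p.2, κ i) :
    (squareP ε κ a b + ∑ p ∈ (pieces ε a b).attach, basepoints ε κ p.1.1 p.1.2).1 -
      (squareP ε κ a b + ∑ p ∈ (pieces ε a b).attach, basepoints ε κ p.1.1 p.1.2).2 =
        ∑ i ∈ Finset.Ico a b, κ i := by
  have hlt := hw.1
  have hε' : ∀ i, ε i = 1 ∨ ε i = 0 ∨ ε i = -1 := fun i => (h.unit i).imp_right Or.inr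
  have hpa := psum_succ ε a
  have hpa' := psum_succ ε (a + 1)
  have hpb := psum_succ ε b
  have hpb' := psum_succ ε (b - 1)
  rw [show b - 1 + 1 = b by omega] at hpb'
  have h1 := hw.one_le_mul_psum hε' (k := a + 1) (by omega) (by omega)
  have h2 := hw.one_le_mul_psum hε' (k := b - 2) (by omega) (by omega)
  rw [show b - 2 + 1 = b - 1 by omega] at h2
  have h3 := hw.psum_eq
  have hb := hw.2.2.1
  rw [ha] at h1 h2 hb hpa
  have ha1 : ε (a + 1) = 1 := by have := h.unit (a + 1); omega
  have hb1 : ε (b - 1) = -1 := by have := h.unit (b - 1); omega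
  have hha : height ε a (a + 1) = 1 := by
    rw [height_eq_level h.unit ha (by omega)]; unfold level; omega
  have hhb : height ε a (b - 1) = 1 := by
    rw [height_eq_level h.unit ha (by omega)]; unfold level
    rw [show b - 1 + 1 = b by omega]; omega
  have hsq := h.same a (b - 1) (by rw [ha1, ha])
    (by rw [show b - 1 + 1 = b by omega, hb, hb1])
  rw [ha, hb1] at hsq
  have hsq' := squareP_fst_sub_snd (ε := ε) (κ := κ) (a := a) (b := b)
    (by convert hsq using 2; ring)
  rw [Finset.sum_attach (pieces ε a b) (fun p => basepoints ε κ p.1 p.2), Prod.fst_add,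
    Prod.snd_add, Prod.fst_sum, Prod.snd_sum, add_sub_add_comm, hsq', ← Finset.sum_sub_distrib,
    Finset.sum_congr rfl ih, sum_pieces hha hhb, Finset.sum_eq_sum_Ico_succ_bot hlt]
  have := Finset.sum_Ico_succ_top (a := a + 1) (b := b - 1) (by omega) κ
  rw [show b - 1 + 1 = b by omega] at this
  rw [this]
  ring

/-- The difference `n_z - n_w` of a primitive disk word is the exponent sum of its `Y`-letters. -/
theorem basepoints_fst_sub_snd (h : IsTame ε κ) {a b : ℕ} (hw : IsPrimitiveDiskWord ε a b) :
    (basepoints ε κ a b).1 - (basepoints ε κ a b).2 = ∑ i ∈ Finset.Ico a b, κ i := by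
  obtain ⟨n, hn⟩ : ∃ n, n = b - a := ⟨_, rfl⟩
  induction n using Nat.strong_induction_on generalizing ε κ a b with
  | _ n ih =>
    have core : ∀ ε' κ', IsTame ε' κ' → IsPrimitiveDiskWord ε' a b → b ≠ a + 1 → ε' a = 1 →
        (squareP ε' κ' a b + ∑ p ∈ (pieces ε' a b).attach, basepoints ε' κ' p.1.1 p.1.2).1 -
          (squareP ε' κ' a b + ∑ p ∈ (pieces ε' a b).attach, basepoints ε' κ' p.1.1 p.1.2).2 =
            ∑ i ∈ Finset.Ico a b, κ' i := fun ε' κ' h' hw' hab ha =>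
      squareP_add_sum_pieces h' hab hw' ha fun p hp => by
        have := (mem_pieces.1 hp).1
        exact ih (p.2 - p.1) (by omega) h' (isPrimitiveDiskWord_of_mem_pieces h'.unit ha hp) rfl
    rw [basepoints.eq_1]
    simp only
    by_cases hab : b = a + 1
    · subst hab
      rw [if_pos rfl]
      have h1 := h.opposite a hw.2.2.1
      rw [abs_eq one_pos.le] at h1
      simp only [Nat.Ico_succ_singleton, Finset.sum_singleton, elementaryP]
      rcases h1 with h1 | h1 <;> rcases h.unit a with h2 | h2 <;> simp [h1, h2]
    rw [if_neg hab]
    by_cases ha : ε a = 1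
    · rw [if_pos ha]
      split_ifs
      · exact core ε κ h hw hab ha
      · have := core ε (-κ) h.neg_right hw hab ha
        simp only [Pi.neg_apply, Finset.sum_neg_distrib] at this
        rw [Prod.fst_neg, Prod.snd_neg]
        linarith
    · have ha' : (-ε) a = 1 := by rw [Pi.neg_apply, (h.unit a).resolve_left ha, neg_neg]
      rw [if_neg ha]
      split_ifs
      · have := core (-ε) (-κ) h.neg_right.neg_left hw.neg hab ha'
        simp only [Pi.neg_apply, Finset.sum_neg_distrib] at this
        rw [Prod.fst_swap, Prod.snd_swap]
        linarith
      · have := core (-ε) κ h.neg_left hw.neg hab ha'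
        rw [Prod.fst_neg, Prod.snd_neg, Prod.fst_swap, Prod.snd_swap]
        linarith

end Basepoints

/-! ### The deletion process -/

section Relators

theorem syllablesAux_unit (e : ℤ) (w : Word) :
    ∀ p ∈ syllablesAux e w, p.1 = 1 ∨ p.1 = -1 := by
  induction w with
  | nil => simp [syllablesAux]
  | cons c w ih =>
    rcases c with ⟨_ | _, b⟩
    · simp only [syllablesAux, List.mem_cons]
      rintro p (rfl | hp)
      · cases b <;> simp [sgn]
      · exact ih p hp
    · exact ih

variable {R : Word}

theorem eps_add_numX (i : ℕ) : eps R (i + numX R) = eps R i := by simp [eps]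

theorem kap_add_numX (i : ℕ) : kap R (i + numX R) = kap R i := by simp [kap]

theorem numX_pos (hR : IsQuasiGeometric R) : 0 < numX R := period_pos (ε := eps R) hR.sum_eps

theorem eps_unit (hR : 0 < numX R) (i : ℕ) : eps R i = 1 ∨ eps R i = -1 := by
  unfold eps
  have h : i % numX R < (syllables R).length := Nat.mod_lt i hR
  rw [List.getD_eq_getElem _ _ h]
  exact syllablesAux_unit _ R _ (List.getElem_mem h)

theorem IsQuasiGeometric.isTame (hR : IsQuasiGeometric R) : IsTame (eps R) (kap R) where
  unit := eps_unit (numX_pos hR)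
  opposite := hR.opposite
  same := hR.same

theorem epsOn_unit (hR : 0 < numX R) (S : Finset ℕ) (i : ℕ) :
    epsOn R S i = 1 ∨ epsOn R S i = 0 ∨ epsOn R S i = -1 := by
  unfold epsOn
  have := eps_unit hR i
  split_ifs <;> omega

theorem epsOn_add_numX (S : Finset ℕ) (i : ℕ) : epsOn R S (i + numX R) = epsOn R S i := by
  simp [epsOn, eps_add_numX]

theorem psum_epsOn {S : Finset ℕ} (hS : S ⊆ Finset.range (numX R)) :
    psum (epsOn R S) (numX R) = ∑ i ∈ S, eps R i := by
  rw [psum, ← Finset.sum_subset hS]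
  · refine Finset.sum_congr rfl fun i hi => ?_
    rw [epsOn, Nat.mod_eq_of_lt (Finset.mem_range.1 (hS hi)), if_pos hi]
  · intro i hi hi'
    rw [epsOn, Nat.mod_eq_of_lt (Finset.mem_range.1 hi), if_neg hi']

theorem eps_mod (i : ℕ) : eps R (i % numX R) = eps R i := by simp [eps]

/-- Deletion of a subword, shorter than the relator, of exponent sum zero does not change the
exponent sum. -/
theorem sum_eps_erase {S : Finset ℕ} {a b : ℕ} (hb : b < a + numX R)
    (h0 : ∑ i ∈ Finset.Icc a b, epsOn R S i = 0) :
    ∑ i ∈ erase R S a b, eps R i = ∑ i ∈ S, eps R i := by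
  have hinj : Set.InjOn (· % numX R) (Finset.Icc a b : Set ℕ) := by
    intro i hi j hj hij
    rw [Finset.mem_coe, Finset.mem_Icc] at hi hj
    rcases le_total i j with h | h
    · have h1 := Nat.eq_zero_of_dvd_of_lt ((Nat.modEq_iff_dvd' h).1 hij) (by omega)
      omega
    · have h1 := Nat.eq_zero_of_dvd_of_lt ((Nat.modEq_iff_dvd' h).1 hij.symm) (by omega)
      omega
  have h1 : ∑ i ∈ (Finset.Icc a b).image (· % numX R), (if i ∈ S then eps R i else 0) = 0 := by
    rw [Finset.sum_image hinj]
    refine Eq.trans (Finset.sum_congr rfl fun i _ => ?_) h0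
    rw [epsOn, eps_mod]
  have h2 := Finset.sum_sdiff (f := eps R)
    (Finset.inter_subset_left (s₁ := S) (s₂ := (Finset.Icc a b).image (· % numX R)))
  rw [Finset.sdiff_inter_self_left, ← Finset.sum_filter] at *
  rw [Finset.filter_mem_eq_inter, Finset.inter_comm] at h1
  rw [h1, add_zero] at h2
  exact h2

theorem mem_erase_iff {S : Finset ℕ} {c d i : ℕ} (hN : 0 < numX R) (hc : c ≤ i) (hcd : c ≤ d)
    (hd : d < c + numX R) :
    i % numX R ∈ erase R S c d ↔ i % numX R ∈ S ∧ d - c < (i - c) % numX R := by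
  rw [erase, Finset.mem_sdiff, Finset.mem_image]
  refine and_congr_right fun _ => ?_
  have hlt := Nat.mod_lt (i - c) hN
  have hmod := Nat.mod_add_div (i - c) (numX R)
  have hi : i = c + (i - c) % numX R + numX R * ((i - c) / numX R) := by omega
  constructor
  · intro h
    by_contra! hle
    refine h ⟨c + (i - c) % numX R, Finset.mem_Icc.2 ⟨by omega, by omega⟩, ?_⟩
    conv_rhs => rw [hi, Nat.add_mul_mod_self_left]
  · rintro h ⟨j, hj, hji⟩
    rw [Finset.mem_Icc] at hj
    have h1 : (i - c) % numX R = (j - c) % numX R := by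
      refine Nat.ModEq.add_left_cancel' c ?_
      rw [show c + (i - c) = i by omega, show c + (j - c) = j by omega]
      exact hji.symm
    rw [h1, Nat.mod_eq_of_lt (by omega)] at h
    omega

/-- A periodic function that is supported on the translates of an interval, on which it sums up to
zero, sums up to zero on every interval whose ends do not lie in these translates. -/
theorem sum_range_eq_zero_of_periodic {N l : ℕ} (hl : l < N) {f : ℕ → ℤ}
    (hf : ∀ i, f (i + N) = f i) (h0 : ∀ i, l < i % N → f i = 0)
    (hs : ∑ i ∈ Finset.range (l + 1), f i = 0) (n : ℕ) (hn : n % N = 0 ∨ l < n % N) :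
    ∑ i ∈ Finset.range n, f i = 0 := by
  have h1 : ∀ r, l < r → r ≤ N → ∑ i ∈ Finset.range r, f i = 0 := by
    intro r hr hrN
    induction r, (show l + 1 ≤ r from hr) using Nat.le_induction with
    | base => exact hs
    | succ r hr' ih =>
      rw [Finset.sum_range_succ, ih hr' (by omega), h0 r (by rw [Nat.mod_eq_of_lt] <;> omega)]
      rfl
  induction n using Nat.strong_induction_on with
  | _ n ih =>
    rcases lt_or_ge n N with hlt | hge
    · rw [Nat.mod_eq_of_lt hlt] at hn
      rcases hn with rfl | hn
      · rfl
      · exact h1 n hn hlt.le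
    · obtain ⟨k, rfl⟩ := Nat.exists_eq_add_of_le hge
      rw [Finset.sum_range_add, h1 N hl le_rfl, zero_add]
      simp only [Nat.add_mod_left] at hn
      rw [← ih k (by omega) hn]
      exact Finset.sum_congr rfl fun i _ => by rw [Nat.add_comm, hf]

theorem isPrimitiveDiskWord_eps_add_mul (hR : IsQuasiGeometric R) {a b : ℕ} (t : ℕ) :
    IsPrimitiveDiskWord (eps R) (a + numX R * t) (b + numX R * t) ↔
      IsPrimitiveDiskWord (eps R) a b :=
  isPrimitiveDiskWord_add_mul_period hR.isTame.unit eps_add_numX hR.sum_eps a b t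

/-- What remains of the primitive disk words with both ends in `S` has exponent sum zero. -/
def IsBalanced (R : Word) (S : Finset ℕ) : Prop :=
  ∀ a b, IsPrimitiveDiskWord (eps R) a b → a % numX R ∈ S → b % numX R ∈ S →
    ∑ i ∈ Finset.Icc a b, epsOn R S i = 0

theorem IsBalanced.erase (hR : IsQuasiGeometric R) {S : Finset ℕ} (hS : IsBalanced R S)
    {c d : ℕ} (hcd : IsPrimitiveDiskWord (eps R) c d) (hc : c % numX R ∈ S)
    (hd : d % numX R ∈ S) : IsBalanced R (erase R S c d) := by
  have hN := numX_pos hR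
  have hlen := hcd.lt_add_period (hR.isTame.unit · |>.imp_right Or.inr) eps_add_numX hR.sum_eps
  intro a b hab ha hb
  -- translate the second subword so that it starts to the right of the first one
  wlog hca : c ≤ a generalizing a b
  · have h1 := this (a + numX R * c) (b + numX R * c)
      ((isPrimitiveDiskWord_eps_add_mul hR c).2 hab) (by simpa using ha) (by simpa using hb)
      (by nlinarith)
    rw [← Finset.map_add_right_Icc, Finset.sum_map] at h1
    simpa [add_mul_period (epsOn_add_numX _)] using h1
  have hlt := hab.1
  rw [mem_erase_iff hN hca hcd.1.le hlen] at ha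
  rw [mem_erase_iff hN (by omega) hcd.1.le hlen] at hb
  have h1 := hS a b hab ha.1 hb.1
  set f : ℕ → ℤ := fun i => if i % numX R ≤ d - c then epsOn R S (c + i) else 0 with hf
  have hsum := sum_range_eq_zero_of_periodic (N := numX R) (l := d - c) (by omega) (f := f)
    (fun i => by simp only [hf, Nat.add_mod_right, ← Nat.add_assoc, epsOn_add_numX])
    (fun i hi => by simp only [hf]; rw [if_neg (by omega)])
    (by
      rw [← hS c d hcd hc hd, ← Finset.Ico_add_one_right_eq_Icc, Finset.sum_Ico_eq_sum_range,
        show d + 1 - c = d - c + 1 by have := hcd.1; omega]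
      refine Finset.sum_congr rfl fun i hi => ?_
      rw [Finset.mem_range] at hi
      simp only [hf]
      rw [if_pos (by rw [Nat.mod_eq_of_lt] <;> omega)])
  have h2 := hsum (a - c) (Or.inr ha.2)
  have h3 := hsum (b + 1 - c) (by
    rw [show b + 1 - c = b - c + 1 by omega]
    have := Nat.mod_lt (b - c) hN
    rcases Nat.lt_or_ge ((b - c) % numX R + 1) (numX R) with h | h
    · right
      rw [← Nat.mod_add_mod, Nat.mod_eq_of_lt h]
      omega
    · left
      rw [← Nat.mod_add_mod, show (b - c) % numX R + 1 = numX R by omega, Nat.mod_self])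
  have h4 : ∀ i ∈ Finset.Icc a b,
      epsOn R (OneOneKnot.erase R S c d) i = epsOn R S i - f (i - c) := by
    intro i hi
    rw [Finset.mem_Icc] at hi
    have := mem_erase_iff (S := S) hN (hca.trans hi.1) hcd.1.le hlen
    simp only [hf, epsOn, show c + (i - c) = i by omega]
    have hle : (i - c) % numX R ≤ d - c ↔ ¬ d - c < (i - c) % numX R := not_lt.symm
    by_cases h : i % numX R ∈ S <;> by_cases h' : d - c < (i - c) % numX R <;>
      simp [this, h, h', hle]
  rw [Finset.sum_congr rfl h4, Finset.sum_sub_distrib, h1, zero_sub, neg_eq_zero]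
  have h5 := Finset.sum_range_add_sum_Ico f (show a - c ≤ b + 1 - c by omega)
  rw [h2, h3, zero_add] at h5
  rw [← h5, ← Finset.Ico_add_one_right_eq_Icc, Finset.sum_Ico_eq_sum_range,
    Finset.sum_Ico_eq_sum_range, show b + 1 - c - (a - c) = b + 1 - a by omega]
  exact Finset.sum_congr rfl fun i _ => by rw [show a + i - c = a - c + i by omega]

/-- The exponent of the letter that survives the deletion process is `1`. -/
theorem IsSurvivor.lt_numX_and_eps_eq_one (hR : IsQuasiGeometric R) {k : ℕ}
    (h : IsSurvivor R k) : k < numX R ∧ eps R k = 1 := by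
  obtain ⟨w, S, -, h1, -, h2⟩ := h
  have hN := numX_pos hR
  have hS : S ⊆ Finset.range (numX R) ∧ ∑ i ∈ S, eps R i = 1 ∧ IsBalanced R S := by
    clear h2
    induction h1 with
    | refl =>
      refine ⟨subset_rfl, hR.sum_eps, fun a b hab _ _ => ?_⟩
      rw [← hab.2.2.2.1]
      refine Finset.sum_congr rfl fun i _ => ?_
      rw [epsOn, if_pos (Finset.mem_range.2 (Nat.mod_lt _ hN))]
    | tail _ hstep ih =>
      obtain ⟨a, b, hab, -, ha, hb, rfl⟩ := hstep
      obtain ⟨i1, i2, i3⟩ := ih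
      refine ⟨Finset.sdiff_subset.trans i1, ?_, i3.erase hR hab ha hb⟩
      rw [sum_eps_erase _ (i3 a b hab ha hb), i2]
      exact hab.lt_add_period (hR.isTame.unit · |>.imp_right Or.inr) eps_add_numX hR.sum_eps
  have hk : ∀ S', Relation.ReflTransGen (SecondStep R w) S S' →
      S' ⊆ Finset.range (numX R) ∧ ∑ i ∈ S', eps R i = 1 := by
    intro S' h
    induction h with
    | refl => exact ⟨hS.1, hS.2.1⟩
    | tail _ hstep ih =>
      obtain ⟨a, b, hab, -, rfl⟩ := hstep
      obtain ⟨i1, i2⟩ := ih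
      refine ⟨Finset.sdiff_subset.trans i1, ?_⟩
      rw [sum_eps_erase _ hab.2.2.2.1, i2]
      exact hab.lt_add_period (epsOn_unit hN _) (epsOn_add_numX _) ((psum_epsOn i1).trans i2)
  simpa using hk _ h2

end Relators

/-! ### The action of Laurent polynomials on the Alexander module -/

section AlexanderModule

variable {G : Type*} [Group G] (g : G)

/-- The class of an element of the commutator subgroup in the Alexander module. -/
def cls (k : commutator G) : AlexanderModule g := Additive.ofMul (Abelianization.of k)

variable {g}

theorem cls_mul (k l : commutator G) : cls g (k * l) = cls g k + cls g l := rfl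

theorem cls_one : cls g 1 = 0 := rfl

theorem cls_inv (k : commutator G) : cls g k⁻¹ = -cls g k := rfl

theorem cls_surjective : Function.Surjective (cls g) := fun a => by
  obtain ⟨k, hk⟩ := QuotientGroup.mk_surjective (s := commutator (commutator G)) a.toMul
  exact ⟨k, congrArg Additive.ofMul hk⟩

theorem tAction_cls (k : commutator G) :
    tAction g (cls g k) = cls g (MulAut.conjNormal g⁻¹ k) := rfl

theorem smul_def (p : ℤ[T;T⁻¹]) (a : AlexanderModule g) : p • a = laurentAction g p a := rfl

theorem T_one_smul_cls (k : commutator G) :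
    (T 1 : ℤ[T;T⁻¹]) • cls g k = cls g (MulAut.conjNormal g⁻¹ k) := by
  have h : laurentAction g (T 1) = (tAction g : AlexanderModule g →ₗ[ℤ] AlexanderModule g) := by
    change AddMonoidAlgebra.lift ℤ (Module.End ℤ (AlexanderModule g)) ℤ _
      (AddMonoidAlgebra.single 1 1) = _
    rw [AddMonoidAlgebra.lift_single]
    simp
    rfl
  rw [← tAction_cls, smul_def, h]
  rfl

/-- `t` acts by conjugation. -/
theorem T_smul_cls (n : ℤ) (k : commutator G) :
    (T n : ℤ[T;T⁻¹]) • cls g k = cls g (MulAut.conjNormal (g ^ (-n)) k) := by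
  have h1 : ∀ k : commutator G, (T (-1) : ℤ[T;T⁻¹]) • cls g k = cls g (MulAut.conjNormal g k) := by
    intro k
    have : k = MulAut.conjNormal g⁻¹ (MulAut.conjNormal g k) := by
      rw [← MulAut.mul_apply, ← map_mul]; simp
    conv_lhs => rw [this]
    rw [← T_one_smul_cls, smul_smul, ← LaurentPolynomial.T_add]
    simp
  induction n generalizing k with
  | zero => simp
  | succ n ih =>
    rw [LaurentPolynomial.T_add, mul_smul, T_one_smul_cls, ih, ← MulAut.mul_apply, ← map_mul]
    congr 3
    group
  | pred n ih =>
    rw [LaurentPolynomial.T_sub, mul_smul, h1, ih, ← MulAut.mul_apply, ← map_mul]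
    congr 3
    group

theorem cls_conj_commutator (c k : commutator G) :
    cls g (MulAut.conjNormal (c : G) k) = cls g k := by
  have : MulAut.conjNormal (c : G) k = c * k * c⁻¹ := Subtype.ext (by simp)
  rw [this, cls_mul, cls_mul, cls_inv]
  abel

theorem abelianization_of_eq_one_iff {h : G} : Abelianization.of h = 1 ↔ h ∈ commutator G := by
  rw [← MonoidHom.mem_ker, Abelianization.ker_of]

/-- Conjugation by an element of the class of `g ^ n` is the action of `t ^ (-n)`. -/
theorem cls_conj {h : G} {n : ℤ} (hn : Abelianization.of h = Abelianization.of g ^ n)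
    (k : commutator G) :
    cls g (MulAut.conjNormal h k) = (T (-n) : ℤ[T;T⁻¹]) • cls g k := by
  have hc : (g ^ n)⁻¹ * h ∈ commutator G := by
    rw [← abelianization_of_eq_one_iff, map_mul, map_inv, map_zpow, hn, inv_mul_cancel]
  have h1 := cls_conj_commutator (g := g) ⟨_, hc⟩ k
  rw [← h1, T_smul_cls, ← MulAut.mul_apply, ← map_mul]
  congr 3
  simp

end AlexanderModule

/-! ### Fox derivatives and affine actions -/

section Fox

/-- The exponent of the image of a letter in the infinite cyclic abelianization: `Y` is sent to `1`
and `X` to `-m`. -/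
def letterDeg (m : ℤ) : Gen × Bool → ℤ
  | (Gen.X, b) => -(m * sgn b)
  | (Gen.Y, b) => sgn b

/-- The exponent of the image of a word in the infinite cyclic abelianization. -/
def wordDeg (m : ℤ) (w : Word) : ℤ := (w.map (letterDeg m)).sum

/-- The Fox derivative of a letter by `X`, with the same substitution as in `fox` below. -/
noncomputable def letterFox (s m : ℤ) : Gen × Bool → ℤ[T;T⁻¹]
  | (Gen.X, true) => 1
  | (Gen.X, false) => -T (s * m)
  | (Gen.Y, _) => 0

/-- The Fox derivative of a word by `X`, with the substitution `Y ↦ t ^ s`, `X ↦ t ^ (-s m)`. -/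
noncomputable def fox (s m : ℤ) : Word → ℤ[T;T⁻¹]
  | [] => 0
  | c :: w => letterFox s m c + T (s * letterDeg m c) * fox s m w

theorem wordDeg_cons (m : ℤ) (c : Gen × Bool) (w : Word) :
    wordDeg m (c :: w) = letterDeg m c + wordDeg m w := by simp [wordDeg]

variable {G : Type*} [Group G]

/-- The value of a letter under `X ↦ x`, `Y ↦ y`. -/
def letterVal (x y : G) : Gen × Bool → G
  | (Gen.X, true) => x
  | (Gen.X, false) => x⁻¹
  | (Gen.Y, true) => y
  | (Gen.Y, false) => y⁻¹

/-- The value of a word under `X ↦ x`, `Y ↦ y`. -/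
def wordVal (x y : G) (w : Word) : G := (w.map (letterVal x y)).prod

theorem wordVal_cons (x y : G) (c : Gen × Bool) (w : Word) :
    wordVal x y (c :: w) = letterVal x y c * wordVal x y w := by simp [wordVal]

theorem map_wordVal {H : Type*} [Group H] (f : G →* H) (x y : G) (w : Word) :
    f (wordVal x y w) = wordVal (f x) (f y) w := by
  rw [wordVal, wordVal, map_list_prod, List.map_map]
  congr 2
  funext c
  rcases c with ⟨_ | _, _ | _⟩ <;> simp [letterVal]

theorem map_freeGroup_mk (f : FreeGroup Gen →* G) (w : Word) :
    f (FreeGroup.mk w) = wordVal (f (FreeGroup.of Gen.X)) (f (FreeGroup.of Gen.Y)) w := by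
  induction w with
  | nil => exact map_one f
  | cons c w ih =>
    rw [wordVal_cons, ← ih, ← List.singleton_append, ← FreeGroup.mul_mk, map_mul]
    congr 1
    rcases c with ⟨_ | _, _ | _⟩
    · exact map_inv f (FreeGroup.of Gen.X)
    · rfl
    · exact map_inv f (FreeGroup.of Gen.Y)
    · rfl

theorem wordVal_eq_zpow {x y : G} {m : ℤ} (hx : x = y ^ (-m)) (w : Word) :
    wordVal x y w = y ^ wordDeg m w := by
  induction w with
  | nil => simp [wordVal, wordDeg]
  | cons c w ih =>
    rw [wordVal_cons, wordDeg_cons, zpow_add, ih]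
    congr 1
    rcases c with ⟨_ | _, _ | _⟩ <;> simp [letterVal, letterDeg, sgn, hx]

/-- The class of the commutator part of a word is a multiple, by the Fox derivative, of the class
of `X Y ^ m`. -/
theorem exists_wordVal_eq {g x y : G} {s m : ℤ}
    (hy : Abelianization.of y = Abelianization.of g ^ (-s))
    {c : commutator G} (hc : x * y ^ m = c) (w : Word) :
    ∃ k : commutator G, wordVal x y w = k * y ^ wordDeg m w ∧ cls g k = fox s m w • cls g c := by
  have hyn : ∀ (n : ℤ) (k : commutator G), cls g (MulAut.conjNormal (y ^ n) k) =
      (T (s * n) : ℤ[T;T⁻¹]) • cls g k := by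
    intro n k
    rw [cls_conj (n := -s * n) (by rw [map_zpow, hy, ← zpow_mul])]
    congr 2
    ring
  have letter : ∀ a, ∃ k : commutator G, letterVal x y a = k * y ^ letterDeg m a ∧
      cls g k = letterFox s m a • cls g c := by
    have hx : x = c * y ^ (-m) := by rw [← hc]; simp
    rintro ⟨_ | _, _ | _⟩
    · refine ⟨MulAut.conjNormal (y ^ m) c⁻¹, ?_, ?_⟩
      · rw [MulAut.conjNormal_apply]
        simp [letterVal, letterDeg, sgn, hx]
      · rw [hyn, cls_inv]
        simp [letterFox]
    · refine ⟨c, ?_, ?_⟩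
      · simp [letterVal, letterDeg, sgn, hx]
      · simp [letterFox]
    · exact ⟨1, by simp [letterVal, letterDeg, sgn], by simp [letterFox, cls_one]⟩
    · exact ⟨1, by simp [letterVal, letterDeg, sgn], by simp [letterFox, cls_one]⟩
  induction w with
  | nil => exact ⟨1, by simp [wordVal, wordDeg], by simp [fox, cls_one]⟩
  | cons a w ih =>
    obtain ⟨k, hk, hk'⟩ := letter a
    obtain ⟨l, hl, hl'⟩ := ih
    refine ⟨k * MulAut.conjNormal (y ^ letterDeg m a) l, ?_, ?_⟩
    · rw [wordVal_cons, wordDeg_cons, hk, hl, zpow_add, Subgroup.coe_mul, MulAut.conjNormal_apply]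
      simp [mul_assoc]
    · rw [cls_mul, hyn, hk', hl', smul_smul, ← add_smul, fox]

section Affine

variable {B : Type*} [AddCommGroup B] [Module ℤ[T;T⁻¹] B]

/-- The affine permutation `b ↦ t ^ n b + v`. -/
noncomputable def affinePerm (n : ℤ) (v : B) : Equiv.Perm B where
  toFun b := (T n : ℤ[T;T⁻¹]) • b + v
  invFun b := (T (-n) : ℤ[T;T⁻¹]) • (b - v)
  left_inv b := by
    simp only
    rw [add_sub_cancel_right, smul_smul, ← LaurentPolynomial.T_add]; simp
  right_inv b := by
    simp only
    rw [smul_smul, ← LaurentPolynomial.T_add]; simp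

theorem affinePerm_mul (n n' : ℤ) (v v' : B) : affinePerm n v * affinePerm n' v' =
    affinePerm (n + n') (v + (T n : ℤ[T;T⁻¹]) • v') := by
  ext b
  simp only [affinePerm, Equiv.Perm.mul_apply, Equiv.coe_fn_mk, LaurentPolynomial.T_add, smul_add,
    mul_smul]
  abel

theorem affinePerm_one : affinePerm 0 (0 : B) = 1 := by ext b; simp [affinePerm]

theorem affinePerm_inv (n : ℤ) (v : B) :
    (affinePerm n v)⁻¹ = affinePerm (-n) (-((T (-n) : ℤ[T;T⁻¹]) • v)) := by
  rw [inv_eq_iff_mul_eq_one, affinePerm_mul, ← affinePerm_one, smul_neg, smul_smul,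
    ← LaurentPolynomial.T_add]
  simp

theorem affinePerm_apply (n : ℤ) (v b : B) :
    affinePerm n v b = (T n : ℤ[T;T⁻¹]) • b + v := rfl

/-- The action of a word by affine permutations is given by its degree and its Fox derivative. -/
theorem wordVal_affinePerm (s m : ℤ) (v : B) (w : Word) :
    wordVal (affinePerm (-(s * m)) v) (affinePerm s (0 : B)) w =
      affinePerm (s * wordDeg m w) (fox s m w • v) := by
  induction w with
  | nil => simp [wordVal, wordDeg, fox, affinePerm_one]
  | cons a w ih =>
    have letter : letterVal (affinePerm (-(s * m)) v) (affinePerm s (0 : B)) a =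
        affinePerm (s * letterDeg m a) (letterFox s m a • v) := by
      rcases a with ⟨_ | _, _ | _⟩ <;>
        simp [letterVal, letterDeg, sgn, letterFox, affinePerm_inv]
    rw [wordVal_cons, ih, letter, affinePerm_mul, wordDeg_cons, fox, mul_add, add_smul, mul_smul]

end Affine

end Fox

/-! ### The Alexander polynomial as a Fox derivative -/

section Presentation

/-- The exponent of `X` in a letter. -/
def letterX : Gen × Bool → ℤ
  | (Gen.X, b) => sgn b
  | (Gen.Y, _) => 0

/-- The exponent sum of `X` in a word. -/
def expX (w : Word) : ℤ := (w.map letterX).sum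

theorem expX_cons (c : Gen × Bool) (w : Word) : expX (c :: w) = letterX c + expX w := by
  simp [expX]

/-- The exponent sum of `Y` in a word. -/
def expY (w : Word) : ℤ := wordDeg 0 w

theorem wordDeg_eq (m : ℤ) (w : Word) : wordDeg m w = expY w - m * expX w := by
  unfold expY
  induction w with
  | nil => simp [wordDeg, expX]
  | cons c w ih =>
    rw [wordDeg_cons, wordDeg_cons, expX_cons, ih]
    rcases c with ⟨_ | _, b⟩ <;> simp only [letterDeg, letterX] <;> ring

theorem wordVal_comm {H : Type*} [CommGroup H] (x y : H) (w : Word) :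
    wordVal x y w = x ^ expX w * y ^ expY w := by
  unfold expY
  induction w with
  | nil => simp [wordVal, wordDeg, expX]
  | cons c w ih =>
    rw [wordVal_cons, wordDeg_cons, expX_cons, ih, zpow_add, zpow_add, mul_mul_mul_comm]
    congr 1
    rcases c with ⟨_ | _, _ | _⟩ <;> simp [letterVal, letterDeg, letterX, sgn]

theorem affinePerm_conj {B : Type*} [AddCommGroup B] [Module ℤ[T;T⁻¹] B] (n : ℤ) (v t : B) :
    affinePerm n v * affinePerm 0 t * (affinePerm n v)⁻¹ =
      affinePerm 0 ((T n : ℤ[T;T⁻¹]) • t) := by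
  rw [mul_inv_eq_iff_eq_mul, affinePerm_mul, affinePerm_mul]
  simp [add_comm]

variable {G : Type*} [Group G] {g : G}

/-- An action of the group by affine permutations, such that the class of `g ^ (-n)` acts with slope
`t ^ n`, restricts to a homomorphism from the Alexander module to the group of translations. -/
theorem exists_linearMap_of_affine {B : Type*} [AddCommGroup B] [Module ℤ[T;T⁻¹] B]
    (ρ : G →* Equiv.Perm B)
    (hρ : ∀ h n, Abelianization.of h = Abelianization.of g ^ (-n) → ∃ v, ρ h = affinePerm n v) :
    ∃ τ : AlexanderModule g →ₗ[ℤ[T;T⁻¹]] B, ∀ k : commutator G, τ (cls g k) = ρ k 0 := by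
  have hk : ∀ k : commutator G, ρ k = affinePerm 0 (ρ k 0) := by
    intro k
    obtain ⟨v, hv⟩ := hρ k 0 (by simpa using abelianization_of_eq_one_iff.2 k.2)
    rw [hv, affinePerm_apply, smul_zero, zero_add]
  let τ₀ : commutator G →* Multiplicative B :=
    { toFun := fun k => Multiplicative.ofAdd (ρ k 0)
      map_one' := by simp
      map_mul' := fun k l => by
        rw [Subgroup.coe_mul, map_mul, hk k, hk l, affinePerm_mul, affinePerm_apply,
          affinePerm_apply, affinePerm_apply]
        simp }
  let τ₁ : AlexanderModule g →+ B := MonoidHom.toAdditiveLeft (Abelianization.lift τ₀)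
  have hτ₁ : ∀ k : commutator G, τ₁ (cls g k) = ρ k 0 := fun k => rfl
  have hT : ∀ (n : ℤ) (a : AlexanderModule g),
      τ₁ ((T n : ℤ[T;T⁻¹]) • a) = (T n : ℤ[T;T⁻¹]) • τ₁ a := by
    intro n a
    obtain ⟨k, rfl⟩ := cls_surjective a
    obtain ⟨v, hv⟩ := hρ (g ^ (-n)) n (map_zpow _ _ _)
    rw [T_smul_cls, hτ₁, hτ₁, MulAut.conjNormal_apply, map_mul, map_mul, map_inv, hv, hk k,
      affinePerm_conj, affinePerm_apply, affinePerm_apply]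
    simp
  refine ⟨{ τ₁ with map_smul' := fun p a => ?_ }, hτ₁⟩
  change τ₁ (p • a) = p • τ₁ a
  induction p using LaurentPolynomial.induction_on' with
  | add p q hp hq => rw [add_smul, add_smul, map_add, hp, hq]
  | C_mul_T n z =>
    have hz : (LaurentPolynomial.C z : ℤ[T;T⁻¹]) = (z : ℤ[T;T⁻¹]) := eq_intCast _ z
    rw [hz, mul_smul, mul_smul, Int.cast_smul_eq_zsmul, Int.cast_smul_eq_zsmul, map_zsmul, hT]

/-- The Alexander polynomial of a group `⟨X, Y | R⟩`, where `R` has exponent sum `1` in `X`, is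
associated to the Fox derivative of `R` by `X`. -/
theorem fox_dvd_and_dvd_fox {R : Word} (hX : expX R = 1) (φ : PresGroup R ≃* G)
    (hg : Function.Bijective (fun n : ℤ => (Abelianization.of g) ^ n)) {Δ : ℤ[T;T⁻¹]}
    (e : AlexanderModule g ≃ₗ[ℤ[T;T⁻¹]] (ℤ[T;T⁻¹] ⧸ Ideal.span {Δ})) :
    ∃ s : ℤ, (s = 1 ∨ s = -1) ∧ fox s (expY R) R ∣ Δ ∧ Δ ∣ fox s (expY R) R := by
  set m := expY R with hm
  let π : FreeGroup Gen →* G := φ.toMonoidHom.comp (PresentedGroup.mk {FreeGroup.mk R})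
  set x := π (FreeGroup.of Gen.X) with hx
  set y := π (FreeGroup.of Gen.Y) with hy
  have hπ : ∀ w, wordVal x y w = π (FreeGroup.mk w) := fun w => (map_freeGroup_mk π w).symm
  have hval : ∀ h : G, ∃ w, wordVal x y w = h := by
    intro h
    classical
    obtain ⟨p, hp⟩ := PresentedGroup.mk_surjective _ (φ.symm h)
    refine ⟨p.toWord, ?_⟩
    rw [hπ, FreeGroup.mk_toWord]
    change φ (PresentedGroup.mk _ p) = h
    rw [hp, MulEquiv.apply_symm_apply]
  have hRmk : PresentedGroup.mk {FreeGroup.mk R} (FreeGroup.mk R) = 1 :=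
    PresentedGroup.one_of_mem rfl
  have hR : wordVal x y R = 1 := by
    rw [hπ]
    change φ (PresentedGroup.mk _ _) = 1
    rw [hRmk, map_one]
  have hdeg0 : wordDeg m R = 0 := by rw [wordDeg_eq, hX]; ring
  have hxy : Abelianization.of x = Abelianization.of y ^ (-m) := by
    have := congrArg Abelianization.of hR
    rw [map_wordVal, wordVal_comm, hX, map_one, zpow_one] at this
    rw [zpow_neg, eq_inv_iff_mul_eq_one]
    exact this
  have hdeg : ∀ w, Abelianization.of (wordVal x y w) = Abelianization.of y ^ wordDeg m w :=
    fun w => by rw [map_wordVal, wordVal_eq_zpow hxy]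
  obtain ⟨s, hs⟩ : ∃ s : ℤ, Abelianization.of y = Abelianization.of g ^ (-s) := by
    obtain ⟨n, hn⟩ := hg.2 (Abelianization.of y)
    exact ⟨-n, by rw [neg_neg]; exact hn.symm⟩
  have hs1 : s = 1 ∨ s = -1 := by
    obtain ⟨w, hw⟩ := hval g
    have h1 := hdeg w
    rw [hw, hs, ← zpow_mul] at h1
    have h2 : (1 : ℤ) = -s * wordDeg m w := hg.1 (by simpa using h1)
    exact Int.isUnit_iff.1 (IsUnit.of_mul_eq_one (-wordDeg m w) (by linarith))
  have hdegs : ∀ w n, Abelianization.of (wordVal x y w) = Abelianization.of g ^ (-n) →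
      s * wordDeg m w = n := by
    intro w n h
    rw [hdeg, hs, ← zpow_mul] at h
    have : -s * wordDeg m w = -n := hg.1 h
    linarith
  have hcC : x * y ^ m ∈ commutator G := by
    rw [← abelianization_of_eq_one_iff, map_mul, hxy, map_zpow, zpow_neg, inv_mul_cancel]
  set c : commutator G := ⟨x * y ^ m, hcC⟩ with hc
  refine ⟨s, hs1, ?_, ?_⟩
  · -- the group acts by affine permutations of the quotient by the Fox derivative
    set J := Ideal.span {fox s m R} with hJ
    let v : ℤ[T;T⁻¹] ⧸ J := Ideal.Quotient.mk J 1
    have hsmul : ∀ p : ℤ[T;T⁻¹], p • v = Ideal.Quotient.mk J p := fun p => by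
      rw [← mul_one p, map_mul, mul_one]; rfl
    let f : Gen → Equiv.Perm (ℤ[T;T⁻¹] ⧸ J)
      | Gen.X => affinePerm (-(s * m)) v
      | Gen.Y => affinePerm s 0
    have hrel : ∀ r ∈ ({FreeGroup.mk R} : Set (FreeGroup Gen)), FreeGroup.lift f r = 1 := by
      rintro r rfl
      rw [map_freeGroup_mk, FreeGroup.lift_apply_of, FreeGroup.lift_apply_of, wordVal_affinePerm,
        hdeg0, hsmul, Ideal.Quotient.eq_zero_iff_mem.2 (Ideal.mem_span_singleton_self _), mul_zero,
        affinePerm_one]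
    let ρ : G →* Equiv.Perm (ℤ[T;T⁻¹] ⧸ J) :=
      (PresentedGroup.toGroup hrel).comp φ.symm.toMonoidHom
    have hρπ : ∀ a, ρ (π (FreeGroup.of a)) = f a := by
      intro a
      change PresentedGroup.toGroup hrel (φ.symm (φ (PresentedGroup.of a))) = _
      rw [MulEquiv.symm_apply_apply, PresentedGroup.toGroup.of]
    obtain ⟨τ, hτ⟩ := exists_linearMap_of_affine (g := g) ρ (by
      intro h n hn
      obtain ⟨w, rfl⟩ := hval h
      rw [map_wordVal, hρπ, hρπ, wordVal_affinePerm, hdegs w n hn]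
      exact ⟨_, rfl⟩)
    have hτc : τ (cls g c) = v := by
      rw [hτ]
      change ρ (x * y ^ m) 0 = v
      rw [map_mul, map_zpow, hρπ, hρπ, Equiv.Perm.mul_apply,
        Equiv.Perm.zpow_apply_eq_self_of_apply_eq_self (by simp [f, affinePerm_apply])]
      simp [f, affinePerm_apply]
    have hΔ : Δ • cls g c = 0 := by
      apply e.injective
      rw [map_smul, map_zero]
      obtain ⟨p, hp⟩ := Ideal.Quotient.mk_surjective (e (cls g c))
      rw [← hp]
      change Ideal.Quotient.mk _ (Δ * p) = 0
      exact Ideal.Quotient.eq_zero_iff_mem.2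
        (Ideal.mul_mem_right _ _ (Ideal.mem_span_singleton_self _))
    rw [← Ideal.mem_span_singleton, ← Ideal.Quotient.eq_zero_iff_mem, ← hsmul, ← hτc, ← map_smul,
      hΔ, map_zero]
  · -- the Fox derivative annihilates the generator of the Alexander module
    have hfox : fox s m R • cls g c = 0 := by
      obtain ⟨k, hk, hk'⟩ := exists_wordVal_eq hs (c := c) rfl R
      rw [hR, hdeg0, zpow_zero, mul_one] at hk
      rw [← hk', show k = 1 from Subtype.ext hk.symm, cls_one]
    have hann : ∀ a : AlexanderModule g, fox s m R • a = 0 := by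
      intro a
      obtain ⟨k, rfl⟩ := cls_surjective a
      obtain ⟨w, hw⟩ := hval k
      have hw0 : wordDeg m w = 0 := by
        have := hdegs w 0 (by rw [hw]; simpa using abelianization_of_eq_one_iff.2 k.2)
        rcases hs1 with h | h <;> rw [h] at this <;> omega
      obtain ⟨l, hl, hl'⟩ := exists_wordVal_eq hs (c := c) rfl w
      rw [hw, hw0, zpow_zero, mul_one] at hl
      rw [show k = l from Subtype.ext hl, hl', smul_smul, mul_comm, mul_smul, hfox, smul_zero]
    rw [← Ideal.mem_span_singleton, ← Ideal.Quotient.eq_zero_iff_mem]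
    have h1 := hann (e.symm (Ideal.Quotient.mk _ 1))
    rw [← map_smul, EmbeddingLike.map_eq_zero_iff] at h1
    rw [← h1, ← mul_one (fox s m R), map_mul, mul_one]
    rfl

end Presentation

/-! ### The Fox derivative as a sum over the letters -/

section Syllables

/-- The exponent of `Y` in the image, in the infinite cyclic abelianization, of the part of the
relator that precedes a letter (and includes it if it is `X⁻¹`). -/
def foxDegree (ε κ : ℕ → ℤ) (m : ℤ) (i : ℕ) : ℤ :=
  psum κ i - m * psum ε i + if ε i = -1 then m else 0

/-- The Fox derivative in terms of the syllables of a word. -/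
noncomputable def syllFox (s m : ℤ) : List (ℤ × ℤ) → ℤ[T;T⁻¹]
  | [] => 0
  | p :: L => (p.1 : ℤ[T;T⁻¹]) * T (s * if p.1 = -1 then m else 0) +
      T (s * (p.2 - m * p.1)) * syllFox s m L

theorem fox_eq_syllFox (s m e : ℤ) (w : Word) :
    fox s m w = T (s * yRun e w) * syllFox s m (syllablesAux e w) := by
  induction w with
  | nil => simp [fox, syllablesAux, syllFox]
  | cons c w ih =>
    rw [fox, ih]
    rcases c with ⟨_ | _, b⟩
    · have h1 : letterFox s m (Gen.X, b) =
          (sgn b : ℤ[T;T⁻¹]) * T (s * if sgn b = -1 then m else 0) := by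
        cases b <;> simp [letterFox, sgn]
      rw [yRun, syllablesAux, syllFox, h1, ← mul_assoc, ← LaurentPolynomial.T_add, mul_zero,
        LaurentPolynomial.T_zero, one_mul]
      simp only [letterDeg]
      congr 3
      ring
    · rw [yRun, syllablesAux, letterFox, zero_add, ← mul_assoc, ← LaurentPolynomial.T_add, mul_add]
      rfl

theorem syllFox_eq_sum (s m : ℤ) (L : List (ℤ × ℤ)) :
    syllFox s m L = ∑ i ∈ Finset.range L.length, ((L.getD i 0).1 : ℤ[T;T⁻¹]) *
      T (s * foxDegree (fun i => (L.getD i 0).1) (fun i => (L.getD i 0).2) m i) := by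
  induction L with
  | nil => simp [syllFox]
  | cons p L ih =>
    rw [syllFox, ih, List.length_cons, Finset.sum_range_succ', add_comm, Finset.mul_sum]
    congr 1
    · refine Finset.sum_congr rfl fun i _ => ?_
      rw [mul_left_comm, ← LaurentPolynomial.T_add, ← mul_add]
      congr 3
      simp only [foxDegree, psum, Finset.sum_range_succ', List.getD_cons_zero, List.getD_cons_succ]
      ring
    · simp [foxDegree, psum]

theorem sum_syllablesAux_fst (e : ℤ) (w : Word) :
    ((syllablesAux e w).map Prod.fst).sum = expX w := by
  induction w with
  | nil => rfl
  | cons c w ih =>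
    rw [expX_cons, ← ih]
    rcases c with ⟨_ | _, b⟩ <;> simp [syllablesAux, letterX]

theorem sum_syllablesAux_snd (e : ℤ) (w : Word) :
    ((syllablesAux e w).map Prod.snd).sum = expY w - yRun e w + e := by
  unfold expY
  induction w with
  | nil => simp [syllablesAux, wordDeg, yRun]
  | cons c w ih =>
    rw [wordDeg_cons]
    rcases c with ⟨_ | _, b⟩
    · rw [syllablesAux, List.map_cons, List.sum_cons, ih, yRun]
      simp only [letterDeg]
      ring
    · rw [syllablesAux, ih, yRun]
      simp only [letterDeg]
      ring

theorem yRun_eq_or (e e' : ℤ) (w : Word) : syllablesAux e w = [] ∨ yRun e w = yRun e' w := by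
  induction w with
  | nil => exact Or.inl rfl
  | cons c w ih =>
    rcases c with ⟨_ | _, b⟩
    · exact Or.inr rfl
    · exact ih.imp id fun h => by rw [yRun, yRun, h]

theorem sum_range_getD {α β : Type*} [AddCommMonoid β] (L : List α) (d : α) (f : α → β) :
    ∑ i ∈ Finset.range L.length, f (L.getD i d) = (L.map f).sum := by
  induction L with
  | nil => rfl
  | cons a L ih =>
    rw [List.length_cons, Finset.sum_range_succ', List.map_cons, List.sum_cons, ← ih, add_comm]
    rfl

variable {R : Word}

theorem psum_eps_numX : psum (eps R) (numX R) = expX R := by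
  rw [psum, ← sum_syllablesAux_fst (yRun 0 R) R]
  refine Eq.trans (Finset.sum_congr rfl fun i hi => ?_) (sum_range_getD (syllables R) 0 Prod.fst)
  rw [eps, Nat.mod_eq_of_lt (Finset.mem_range.1 hi)]

theorem psum_kap_numX (hR : 0 < numX R) : psum (kap R) (numX R) = expY R := by
  have h1 : psum (kap R) (numX R) = ((syllables R).map Prod.snd).sum := by
    rw [psum]
    refine Eq.trans (Finset.sum_congr rfl fun i hi => ?_) (sum_range_getD (syllables R) 0 Prod.snd)
    rw [kap, Nat.mod_eq_of_lt (Finset.mem_range.1 hi)]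
  rw [h1, syllables, sum_syllablesAux_snd]
  rcases yRun_eq_or (yRun 0 R) 0 R with h | h
  · exact absurd (List.length_eq_zero_iff.2 h) hR.ne'
  · rw [h]; ring

theorem psum_congr {f f' : ℕ → ℤ} {n i : ℕ} (h : ∀ k < n, f k = f' k) (hi : i ≤ n) :
    psum f i = psum f' i :=
  Finset.sum_congr rfl fun k hk => h k (lt_of_lt_of_le (Finset.mem_range.1 hk) hi)

/-- The Fox derivative of the relator, up to a unit, as a sum over its `X`-letters. -/
theorem fox_eq_sum (s m : ℤ) (R : Word) : ∃ n : ℤ, fox s m R =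
    T n * ∑ i ∈ Finset.range (numX R),
      (eps R i : ℤ[T;T⁻¹]) * T (s * foxDegree (eps R) (kap R) m i) := by
  refine ⟨s * yRun (yRun 0 R) R, ?_⟩
  rw [fox_eq_syllFox s m (yRun 0 R) R, syllFox_eq_sum]
  congr 1
  refine Finset.sum_congr rfl fun i hi => ?_
  have hi' : i < numX R := Finset.mem_range.1 hi
  have h1 : ∀ k < numX R, ((syllables R).getD k 0) = (eps R k, kap R k) := fun k hk => by
    rw [eps, kap, Nat.mod_eq_of_lt hk]
  have h2 := h1 i hi'
  unfold syllables at h1 h2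
  simp only [foxDegree, h2]
  have h3 := psum_congr (f := fun i => ((syllablesAux (yRun 0 R) R).getD i 0).2) (f' := kap R)
    (fun k hk => by rw [h1 k hk]) hi'.le
  have h4 := psum_congr (f := fun i => ((syllablesAux (yRun 0 R) R).getD i 0).1) (f' := eps R)
    (fun k hk => by rw [h1 k hk]) hi'.le
  rw [h3, h4]

theorem foxDegree_add_numX (hR : IsQuasiGeometric R) (i : ℕ) :
    foxDegree (eps R) (kap R) (expY R) (i + numX R) = foxDegree (eps R) (kap R) (expY R) i := by
  have hk : ∀ i, psum (kap R) (i + numX R) = psum (kap R) i + expY R := by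
    intro i
    induction i with
    | zero => rw [Nat.zero_add, psum_kap_numX (numX_pos hR)]; simp [psum]
    | succ i ih => rw [Nat.add_right_comm, psum_succ, psum_succ, ih, kap_add_numX]; ring
  rw [foxDegree, foxDegree, hk, psum_add_period eps_add_numX hR.sum_eps, eps_add_numX]
  ring

theorem foxDegree_mod (hR : IsQuasiGeometric R) (i : ℕ) :
    foxDegree (eps R) (kap R) (expY R) (i % numX R) = foxDegree (eps R) (kap R) (expY R) i := by
  conv_rhs => rw [← Nat.mod_add_div i (numX R)]
  rw [add_mul_period (foxDegree_add_numX hR)]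

theorem foxDegree_sub {ε κ : ℕ → ℤ} (hε : ∀ i, ε i = 1 ∨ ε i = -1) (m : ℤ) {a b : ℕ}
    (h : IsPrimitiveDiskWord ε a b) :
    foxDegree ε κ m b - foxDegree ε κ m a = ∑ i ∈ Finset.Ico a b, κ i := by
  rw [Finset.sum_Ico_eq_sub _ h.1.le]
  change _ = psum κ b - psum κ a
  have h1 := h.psum_eq
  rw [psum_succ, h.2.2.1] at h1
  have h2 := h.2.2.1
  unfold foxDegree
  rw [← h1]
  rcases hε a with h3 | h3 <;> rw [h3] at h2 ⊢ <;> rw [h2] <;> norm_num <;> ring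

end Syllables

/-! ### Gradings of the letters -/

section Gradings

variable {R : Word}

/-- The relative Alexander grading is minus the exponent of the Fox derivative. -/
theorem IsRelAlexander.exists_eq (hR : IsQuasiGeometric R) {F : ℕ → ℤ} (hF : IsRelAlexander R F) :
    ∃ n : ℤ, ∀ i < numX R, F i = n - foxDegree (eps R) (kap R) (expY R) i := by
  have hN := numX_pos hR
  set A := foxDegree (eps R) (kap R) (expY R) with hA
  refine ⟨F 0 + A 0, fun i hi => ?_⟩
  have := eq_of_forall_primitiveDiskWord (f := fun i => F i + A i) hR.isTame.unit eps_add_numX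
    hR.sum_eps (fun a b hab => by
      have h1 := hF a b hab
      rw [nz, nw, basepoints_fst_sub_snd hR.isTame hab, ← foxDegree_sub hR.isTame.unit (expY R) hab,
        ← hA] at h1
      simp only [hA, foxDegree_mod hR] at h1 ⊢
      linarith) hi hN
  linarith

/-- In an absolute Maslov grading the parity of the degree of a letter is given by its exponent. -/
theorem IsMaslovGrading.neg_one_zpow_eq (hR : IsQuasiGeometric R) {M : ℕ → ℤ}
    (hM : IsMaslovGrading R M) {i : ℕ} (hi : i < numX R) :
    (((-1 : ℤˣ) ^ M i : ℤˣ) : ℤ) = eps R i := by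
  obtain ⟨hM, k, hk, hk0⟩ := hM
  obtain ⟨hkN, hk1⟩ := hk.lt_numX_and_eps_eq_one hR
  have h := eq_of_forall_primitiveDiskWord (f := fun i => (((-1 : ℤˣ) ^ M i : ℤˣ) : ℤ) * eps R i)
    hR.isTame.unit eps_add_numX hR.sum_eps (fun a b hab => by
      have h1 := hM a b hab
      have h2 := hab.2.2.1
      have h3 : ((-1 : ℤˣ) ^ M (a % numX R)) = -(-1) ^ M (b % numX R) := by
        obtain ⟨c, hc⟩ : ∃ c, M (a % numX R) = M (b % numX R) + (2 * c + 1) := by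
          split_ifs at h1
          · exact ⟨-nw R a b, by linarith⟩
          · exact ⟨-nw R a b - 1, by linarith⟩
        rw [hc, zpow_add, zpow_add, zpow_mul]
        simp
      simp only [eps_mod, h2, h3, Units.val_neg]
      ring) hi hkN
  simp only [hk0, hk1, zpow_zero, Units.val_one, mul_one] at h
  rcases hR.isTame.unit i with h' | h' <;> rw [h'] at h ⊢ <;> linarith

theorem isPositive_add_mul (a b t : ℕ) :
    IsPositive (eps R) (kap R) (a + numX R * t) (b + numX R * t) ↔
      IsPositive (eps R) (kap R) a b := by
  unfold IsPositive orientation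
  rw [← Finset.sum_Ico_add']
  refine iff_of_eq (congrArg _ (Finset.sum_congr rfl fun i _ => ?_))
  rw [Nat.add_right_comm, add_mul_period eps_add_numX, add_mul_period eps_add_numX,
    add_mul_period kap_add_numX]

theorem exists_isMaslovGrading (hR : IsPseudoGeometric R) : ∃ M, IsMaslovGrading R M := by
  obtain ⟨k, hk⟩ := hR.survivor
  obtain ⟨w, -, hw, -⟩ := id hk
  have hQ := hR.toIsQuasiGeometric
  obtain ⟨f, hf⟩ := exists_potential hQ.isTame.unit eps_add_numX hQ.sum_eps
    (v := fun a b => if IsPositive (eps R) (kap R) a b then 1 else -1)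
    (fun a b t => by simp only [isPositive_add_mul])
  refine ⟨fun i => (f i - 2 * w i) - (f k - 2 * w k), fun a b hab => ?_, k, hk, sub_self _⟩
  have h1 := hf a b hab
  have h2 := hw a b hab
  simp only at h1 ⊢
  linarith

end Gradings

/-! ### Laurent polynomials -/

section Laurent

/-- The units of `ℤ[t, t⁻¹]` are monomials. -/
theorem exists_eq_C_mul_T_of_isUnit {u : ℤ[T;T⁻¹]} (hu : IsUnit u) :
    ∃ (z : ℤ) (n : ℤ), u = LaurentPolynomial.C z * T n := by
  obtain ⟨v, huv⟩ := isUnit_iff_exists_inv.1 hu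
  obtain ⟨k, p, hp⟩ := LaurentPolynomial.exists_T_pow u
  obtain ⟨l, q, hq⟩ := LaurentPolynomial.exists_T_pow v
  have hpq : p * q = Polynomial.X ^ (k + l) := by
    apply Polynomial.toLaurent_injective
    rw [map_mul, hp, hq, Polynomial.toLaurent_X_pow, mul_mul_mul_comm, huv, one_mul,
      ← LaurentPolynomial.T_add, Nat.cast_add]
  obtain ⟨j, -, hj⟩ := (dvd_prime_pow Polynomial.prime_X _).1 ⟨q, hpq.symm⟩
  obtain ⟨z, hz⟩ := hj.symm
  obtain ⟨r, -, hr⟩ := Polynomial.isUnit_iff.1 z.isUnit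
  refine ⟨r, j - k, ?_⟩
  have h : u = Polynomial.toLaurent p * T (-k) := by
    rw [hp, LaurentPolynomial.mul_T_assoc]; simp
  rw [h, ← hz, ← hr, map_mul, Polynomial.toLaurent_X_pow, Polynomial.toLaurent_C,
    LaurentPolynomial.T_sub]
  ring

theorem evalOne_T (n : ℤ) : evalOne (T n) = 1 := by simp [evalOne]

theorem evalOne_C (z : ℤ) : evalOne (LaurentPolynomial.C z) = z := by simp [evalOne]

/-- Reduction modulo two of the coefficients. -/
noncomputable def modTwo : ℤ[T;T⁻¹] →+* (ZMod 2)[T;T⁻¹] :=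
  LaurentPolynomial.eval₂ (Int.castRingHom _)
    ⟨T 1, T (-1), by rw [← LaurentPolynomial.T_add, add_neg_cancel, LaurentPolynomial.T_zero],
      by rw [← LaurentPolynomial.T_add, neg_add_cancel, LaurentPolynomial.T_zero]⟩

theorem modTwo_T (n : ℤ) : modTwo (T n) = T n := by
  rw [modTwo, LaurentPolynomial.eval₂_T]
  induction n with
  | zero => simp
  | succ n ih => rw [zpow_add_one, Units.val_mul, ih, LaurentPolynomial.T_add]
  | pred n ih => rw [LaurentPolynomial.T_sub, zpow_sub_one, Units.val_mul, ih]; rfl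

theorem modTwo_invert (p : ℤ[T;T⁻¹]) :
    modTwo (LaurentPolynomial.invert p) = LaurentPolynomial.invert (modTwo p) := by
  induction p using LaurentPolynomial.induction_on' with
  | add p q hp hq => simp only [map_add, hp, hq]
  | C_mul_T n z =>
    rw [eq_intCast LaurentPolynomial.C z]
    simp only [map_mul, map_intCast, LaurentPolynomial.invert_T, modTwo_T]

theorem modTwo_ne_zero {p : ℤ[T;T⁻¹]} (hp : evalOne p = 1) : modTwo p ≠ 0 := by
  have h : ∀ p,
      LaurentPolynomial.eval₂ (RingHom.id (ZMod 2)) 1 (modTwo p) = (evalOne p : ZMod 2) := by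
    intro p
    induction p using LaurentPolynomial.induction_on' with
    | add p q hp hq => rw [map_add, map_add, map_add, hp, hq, Int.cast_add]
    | C_mul_T n z =>
      rw [eq_intCast LaurentPolynomial.C z]
      simp [modTwo_T, evalOne_T]
  intro h0
  have := h p
  rw [h0, hp] at this
  simp at this

/-- A Laurent polynomial that is associated to a symmetric one, that has the same value `1` at `1`,
and that is symmetric modulo two is equal to it. -/
theorem eq_of_dvd_of_symmetric_modTwo {E Δ : ℤ[T;T⁻¹]} (h1 : E ∣ Δ) (h2 : Δ ∣ E)
    (hE : evalOne E = 1) (hΔ : evalOne Δ = 1) (hinv : LaurentPolynomial.invert Δ = Δ)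
    (hsymm : LaurentPolynomial.invert (modTwo E) = modTwo E) : E = Δ := by
  obtain ⟨u, hu⟩ := associated_of_dvd_dvd h2 h1
  obtain ⟨z, n, hzn⟩ := exists_eq_C_mul_T_of_isUnit u.isUnit
  have hz : z = 1 := by
    have := congrArg evalOne hu
    rw [map_mul, hzn, map_mul, evalOne_T, evalOne_C, hE, hΔ] at this
    linarith
  rw [hzn, hz, map_one, one_mul] at hu
  rw [← hu, map_mul, map_mul, ← modTwo_invert, hinv, modTwo_T, LaurentPolynomial.invert_T] at hsymm
  have h3 := mul_left_cancel₀ (modTwo_ne_zero hΔ) hsymm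
  have h4 : n = 0 := by
    have := congrArg (fun p => p.coeff n) h3
    simp only [LaurentPolynomial.T_apply, if_true] at this
    by_contra hn
    rw [if_neg (by omega)] at this
    exact zero_ne_one this
  rw [← hu, h4, LaurentPolynomial.T_zero, mul_one]

/-- The value of the Poincaré polynomial at `q = -1`. -/
theorem evalNegOne_poincare {R : Word} {F M : ℕ → ℤ}
    (hM : ∀ i < numX R, (((-1 : ℤˣ) ^ M i : ℤˣ) : ℤ) = eps R i) :
    evalNegOne (poincare R F M) = ∑ i ∈ Finset.range (numX R), (eps R i : ℤ[T;T⁻¹]) * T (F i) := by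
  rw [poincare, map_sum]
  refine Finset.sum_congr rfl fun i hi => ?_
  rw [evalNegOne, LaurentPolynomial.eval₂_C_mul_T, ← hM i (Finset.mem_range.1 hi), mul_comm]
  congr 1
  rcases Int.even_or_odd (M i) with h | h <;> simp [h.neg_one_zpow]

theorem invert_modTwo_sum {R : Word} (hR : IsQuasiGeometric R) {F : ℕ → ℤ}
    (hF : IsAlexanderGrading R F) :
    LaurentPolynomial.invert
        (modTwo (∑ i ∈ Finset.range (numX R), (eps R i : ℤ[T;T⁻¹]) * T (F i))) =
      modTwo (∑ i ∈ Finset.range (numX R), (eps R i : ℤ[T;T⁻¹]) * T (F i)) := by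
  have h1 : modTwo (∑ i ∈ Finset.range (numX R), (eps R i : ℤ[T;T⁻¹]) * T (F i)) =
      ∑ i ∈ Finset.range (numX R), T (F i) := by
    rw [map_sum]
    refine Finset.sum_congr rfl fun i _ => ?_
    have h2 : (-1 : (ZMod 2)[T;T⁻¹]) = 1 := by
      rw [← map_one LaurentPolynomial.C, ← map_neg, show (-1 : ZMod 2) = 1 from rfl]
    rw [map_mul, map_intCast, modTwo_T]
    rcases hR.isTame.unit i with h | h <;> simp [h, h2]
  have h2 : ∀ (f : ℕ → ℤ) (s : ℤ),
      (∑ i ∈ Finset.range (numX R), (T (f i) : (ZMod 2)[T;T⁻¹])).coeff s =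
        ((Finset.range (numX R)).filter fun i => f i = s).card := by
    intro f s
    rw [Finset.card_filter, Nat.cast_sum, AddMonoidAlgebra.coeff_sum, Finset.sum_apply']
    exact Finset.sum_congr rfl fun i _ => by rw [LaurentPolynomial.T_apply, Nat.cast_ite]; simp
  rw [h1]
  ext s
  rw [LaurentPolynomial.invert_apply, h2, h2]
  exact ((ZMod.natCast_eq_natCast_iff _ _ _).2 (hF.2 s)).symm

end Laurent

/-! ### The Poincaré polynomial -/

section Main

/-- The value at `q = -1` of the Poincaré polynomial is the Alexander polynomial of the group of the
presentation. -/
theorem evalNegOne_poincare_eq {G : Type*} [Group G] {R : Word} (hQ : IsQuasiGeometric R)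
    (φ : PresGroup R ≃* G) {F M : ℕ → ℤ} (hF : IsAlexanderGrading R F) (hM : IsMaslovGrading R M)
    {Δ : ℤ[T;T⁻¹]} (hΔ : IsAlexanderPolynomial G Δ) : evalNegOne (poincare R F M) = Δ := by
  obtain ⟨⟨g, hg, ⟨e⟩⟩, hinv, hone⟩ := hΔ
  have hX : expX R = 1 := psum_eps_numX.symm.trans hQ.sum_eps
  obtain ⟨s, hs, h1, h2⟩ := fox_dvd_and_dvd_fox hX φ hg e
  obtain ⟨r, hr⟩ := fox_eq_sum s (expY R) R
  rw [hr, (LaurentPolynomial.isUnit_T r).mul_left_dvd] at h1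
  rw [hr, (LaurentPolynomial.isUnit_T r).dvd_mul_left] at h2
  rw [evalNegOne_poincare fun i => hM.neg_one_zpow_eq hQ]
  obtain ⟨n, hn⟩ := hF.1.exists_eq hQ
  set A := foxDegree (eps R) (kap R) (expY R) with hA
  have hE : ∀ f : ℕ → ℤ,
      evalOne (∑ i ∈ Finset.range (numX R), (eps R i : ℤ[T;T⁻¹]) * T (f i)) = 1 := by
    intro f
    rw [map_sum, ← hQ.sum_eps]
    exact Finset.sum_congr rfl fun i _ => by rw [map_mul, map_intCast, evalOne_T]; simp
  have hsum : ∑ i ∈ Finset.range (numX R), (eps R i : ℤ[T;T⁻¹]) * T (F i) =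
      T n * ∑ i ∈ Finset.range (numX R), (eps R i : ℤ[T;T⁻¹]) * T (-1 * A i) := by
    rw [Finset.mul_sum]
    refine Finset.sum_congr rfl fun i hi => ?_
    rw [hn i (Finset.mem_range.1 hi), LaurentPolynomial.T_sub]
    ring_nf
  -- the sign of `s` depends on the generator of the abelianization; it does not matter, because the
  -- Alexander polynomial is symmetric
  have h3 : (∑ i ∈ Finset.range (numX R), (eps R i : ℤ[T;T⁻¹]) * T (-1 * A i)) ∣ Δ ∧
      Δ ∣ ∑ i ∈ Finset.range (numX R), (eps R i : ℤ[T;T⁻¹]) * T (-1 * A i) := by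
    rcases hs with rfl | rfl
    · have h : ∑ i ∈ Finset.range (numX R), (eps R i : ℤ[T;T⁻¹]) * T (-1 * A i) =
          LaurentPolynomial.invert
            (∑ i ∈ Finset.range (numX R), (eps R i : ℤ[T;T⁻¹]) * T (1 * A i)) := by
        simp [map_sum]
      rw [h, ← hinv]
      exact ⟨map_dvd LaurentPolynomial.invert h1, map_dvd LaurentPolynomial.invert h2⟩
    · exact ⟨h1, h2⟩
  refine eq_of_dvd_of_symmetric_modTwo ?_ ?_ (hE F) hone hinv (invert_modTwo_sum hQ hF)
  · rw [hsum, (LaurentPolynomial.isUnit_T n).mul_left_dvd]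
    exact h3.1
  · rw [hsum, (LaurentPolynomial.isUnit_T n).dvd_mul_left]
    exact h3.2

end Main

end OneOneKnot

theorem corollary5p2 (K : Set S3) (hK : IsOneOneKnot K) (x : (Kᶜ : Set S3))
    (R : Word) (hR : IsPseudoGeometric R) (hpres : Nonempty (PresGroup R ≃* KnotGroup K x))
    (Δ : LaurentPolynomial ℤ) (hΔ : IsAlexanderPolynomial (KnotGroup K x) Δ) :
    (∃ P, IsPoincarePolynomial R P) ∧
      ∀ P, IsPoincarePolynomial R P → evalNegOne P = Δ := by
  refine ⟨?_, ?_⟩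
  · obtain ⟨F, hF⟩ := hR.alexander
    obtain ⟨M, hM⟩ := exists_isMaslovGrading hR
    exact ⟨_, F, M, hF, hM, rfl⟩
  · rintro _ ⟨F, M, hF, hM, rfl⟩
    obtain ⟨φ⟩ := hpres
    exact evalNegOne_poincare_eq hR.toIsQuasiGeometric φ hF hM hΔ
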